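/- Logarithms are to base $2$; $h(p)=-p\log p-(1-p)\log(1-p)$, and $h^{-1}:[0,1]\to[0,1/2]$ is the inverse of the restriction of $h$ to $[0,1/2]$. For $t\in[0,1]$ let $$\eta_t=\bigl(1-2h^{-1}(1-t)\bigr)^2,\qquad \alpha_t=\frac{t}{\eta_t},$$ with the convention $\alpha_0=0$. The capacity of a memoryless channel is the supremum over input distributions of the mutual information between one channel input and the corresponding output. A memoryless channel with input $X\in\{0,1\}$ and output $Y$ (in an arbitrary measurable space) is called binary-input memoryless output-symmetric (BMS) if there is a sufficient statistic $T=(X\oplus Z_A,A)$ of $Y$ for $X$, possibly randomized (that is, $T$ is produced from $Y$ by a Markov kernel, and some Markov kernel, not depending on $X$, gives the conditional law of $Y$ given $(T,X)$), where $(A,Z_A)$ is independent of $X$, $A\in[0,1]$, $Z_A\in\{0,1\}$ and $\Pr(Z_A=1\mid A=a)=a$. Let $n\ge 0$, let $C\subset\{0,1\}^n$ be a linear code over $\mathbb F_2$, let $u\in\{0,1\}^n$, and let $X^n$ be uniformly distributed on $C+u$. Let $t\in[0,1]$. Denote by $I_{\mathrm{BMS}}^{(t)}(X^n;Y^n)$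 the mutual information between $X^n$ and the output of $n$ uses of a given BMS channel of capacity $t$, and by $I_{\mathrm{BEC}}^{(s)}(X^n;Y^n)$ the mutual information between $X^n$ and the output of $n$ uses of the binary erasure channel of capacity $s$. Then for every BMS channel of capacity $t$, $$\alpha_t\cdot I_{\mathrm{BEC}}^{(\eta_t)}(X^n;Y^n)\;\le\; I_{\mathrm{BMS}}^{(t)}(X^n;Y^n)\;\le\; I_{\mathrm{BEC}}^{(t)}(X^n;Y^n).$$ -/

import Mathlib

open MeasureTheory ProbabilityTheory
open scoped ENNReal unitInterval

namespace BMS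

noncomputable section

/-- Mutual information `I(X;Y)` in bits between an input `X` of law `P` and the output `Y` of the
channel `W` with input `X`: the Kullback-Leibler divergence (base 2) of the joint law from the
product of the two marginals. -/
def mutualInfo {α β : Type*} [MeasurableSpace α] [MeasurableSpace β]
    (P : Measure α) (W : Kernel α β) : ℝ≥0∞ :=
  InformationTheory.klDiv (P ⊗ₘ W) (P.prod (W ∘ₘ P)) / ENNReal.ofReal (Real.log 2)

/-- Capacity (in bits per use) of a memoryless channel with single-use transition kernel `W`: the
supremum of the mutual information over all input distributions. -/
def capacity {α β : Type*} [MeasurableSpace α] [MeasurableSpace β] (W : Kernel α β) : ℝ≥0∞ :=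
  ⨆ P : ProbabilityMeasure α, mutualInfo (P : Measure α) W

/-- `n` uses of the memoryless binary-input channel with single-use transition kernel `W`: given
the input `x`, the outputs are independent and the `i`-th one has law `W (x i)`. -/
def memoryless (n : ℕ) {β : Type*} [MeasurableSpace β] (W : Kernel (ZMod 2) β) :
    Kernel (Fin n → ZMod 2) (Fin n → β) :=
  Kernel.ofFunOfCountable fun x => Measure.pi fun i => W (x i)

instance (n : ℕ) {β : Type*} [MeasurableSpace β] (W : Kernel (ZMod 2) β) [IsMarkovKernel W] :
    IsMarkovKernel (memoryless n W) :=
  ⟨fun x => by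
    change IsProbabilityMeasure (Measure.pi fun i => W (x i))
    infer_instance⟩

/-- The binary erasure channel with erasure probability `e`; the output `Sum.inr ()` is the
erasure symbol. -/
def bec (e : I) : Kernel (ZMod 2) (ZMod 2 ⊕ Unit) :=
  Kernel.ofFunOfCountable fun x =>
    ENNReal.ofReal (1 - (e : ℝ)) • Measure.dirac (Sum.inl x) +
      ENNReal.ofReal (e : ℝ) • Measure.dirac (Sum.inr ())

instance (e : I) : IsMarkovKernel (bec e) :=
  ⟨fun x => ⟨by
    change (ENNReal.ofReal (1 - (e : ℝ)) • Measure.dirac (Sum.inl x) +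
      ENNReal.ofReal (e : ℝ) • Measure.dirac (Sum.inr ()) : Measure (ZMod 2 ⊕ Unit)) Set.univ = 1
    have h0 : (0 : ℝ) ≤ 1 - e := sub_nonneg.2 e.2.2
    simp [← ENNReal.ofReal_add h0 e.2.1]⟩⟩

/-- The statistic `T`, produced from the output `Y` of the channel `W` by the (possibly
randomized) rule `K`, is sufficient for the input: there is a version `R` of the conditional law
of `Y` given `T` that does not depend on the input `x`. A deterministic statistic is the case
where every `K y` is a Dirac measure. -/
def IsSufficientStatistic {α β τ : Type*} [MeasurableSpace α] [MeasurableSpace β]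
    [MeasurableSpace τ] (W : Kernel α β) (K : Kernel β τ) : Prop :=
  ∃ R : Kernel τ β, IsMarkovKernel R ∧
    ∀ x, (W x ⊗ₘ K).map Prod.swap = (K ∘ₘ W x) ⊗ₘ R

/-- Binary-input memoryless output-symmetric channels (addition in `ZMod 2` is `⊕`): there is a
sufficient statistic `T = (X ⊕ Z, A)`, where the law `N` of `(Z, A)` does not depend on the
input and `Pr(Z = 1 | A = a) = a`. -/
def IsBMS {β : Type*} [MeasurableSpace β] (W : Kernel (ZMod 2) β) : Prop :=
  IsMarkovKernel W ∧
  ∃ (K : Kernel β (ZMod 2 × I)) (N : Measure (ZMod 2 × I)),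
    IsMarkovKernel K ∧ IsProbabilityMeasure N ∧
    (∀ S : Set I, MeasurableSet S →
      N ({1} ×ˢ S) = ∫⁻ a in S, ENNReal.ofReal (a : ℝ) ∂N.snd) ∧
    (∀ x : ZMod 2, K ∘ₘ W x = N.map fun p => (x + p.1, p.2)) ∧
    IsSufficientStatistic W K

/-- The uniform distribution on the shifted linear code `C + u`. -/
def shiftedCodeLaw {n : ℕ} (C : Submodule (ZMod 2) (Fin n → ZMod 2)) (u : Fin n → ZMod 2) :
    Measure (Fin n → ZMod 2) :=
  uniformOn {x | ∃ c ∈ C, x = c + u}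

/-- The binary entropy function, in bits. -/
def h (p : ℝ) : ℝ := Real.binEntropy p / Real.log 2

/-- The inverse of the restriction of `h` to `[0, 1/2]` (meaningful on `[0, 1]`). -/
def hInv : ℝ → ℝ := Function.invFunOn h (Set.Icc 0 (1 / 2))

/-- `η_t = (1 - 2 h⁻¹(1 - t))²`. -/
def eta (t : ℝ) : ℝ := (1 - 2 * hInv (1 - t)) ^ 2

/-- `α_t = t / η_t` (with value `0` at `t = 0`, where `η_t = 0`). -/
def alpha (t : ℝ) : ℝ := t / eta t

end

end BMS

/-! By sufficiency, a BMS channel and a mixture of binary symmetric channels whose crossover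
probability `s`, of law `M`, is revealed to the receiver simulate each other
(`IsBMS.exists_bscMix`). By data processing the two have the same mutual informations and the same
capacity, `∫ biasInfo (1 - 2s) ∂M / log 2`. The erasure channel is the mixture supported on `0`
(noiseless) and `half` (useless), so everything reduces to comparing integrals of `outInfo p a` over
product laws of the crossovers `a`.

Fix a coordinate `i` and let `B` be the bias of the `i`-th input bit given the other outputs.
Observing output `i` with crossover `s` gains `E[biasInfo (1 - 2s) - biasInfo ((1 - 2s) B)]`
(`outInfo_update_sub`). Since `biasInfo x` is a power series in `x ^ 2` with nonnegative
coefficients of sum `log 2`, there are two bounds for it.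

Upper bound: Chebyshev's sum inequality gives `biasInfo x * biasInfo y ≤ log 2 * biasInfo (x * y)`.
Hence the gain is at most the gain through an erasure channel carrying as much information, and
coordinates are exchanged one at a time. This works for every input law.

Lower bound: `biasInfo (x * y) ≤ y ^ 2 * biasInfo x` gives an average gain of at least `t log 2 (1 -
E B ^ 2)`. For an input uniform on a coset and for erasures, `B` takes only the values `0, ±1`, so
the gain through an erasure channel of capacity `η` is exactly `η log 2 (1 - E B ^ 2)`. It remains
to see that `E B ^ 2` is no larger for `M` than for erasures of capacity `eta t`. In each other
crossover `s` it lies below a chord in the variable `(1 - 2s) ^ 2` (`meanSqBias_update_le`), and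
Jensen's inequality gives `∫ (1 - 2s) ^ 2 ∂M ≤ eta t` (`integral_sq_bias_le_eta`). Adding the gains
over the coordinates concludes. -/

namespace BMS
noncomputable section

/-! ### Power series of the bias information -/

/-- The information (in nats) that a uniform bit passed through a binary symmetric channel of
crossover probability `(1 - x) / 2` carries. -/
def biasInfo (x : ℝ) : ℝ := Real.log 2 - Real.binEntropy ((1 - x) / 2)

/-- The Taylor coefficients of `biasInfo` (as a power series in the square). -/
def biasCoeff (k : ℕ) : ℝ := 1 / ((2 * k + 1) * (2 * k + 2))

lemma biasCoeff_nonneg (k : ℕ) : 0 ≤ biasCoeff k := by unfold biasCoeff; positivity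

@[fun_prop]
lemma continuous_biasInfo : Continuous biasInfo := by unfold biasInfo; fun_prop

lemma biasInfo_zero : biasInfo 0 = 0 := by
  simp [biasInfo]

lemma biasInfo_one : biasInfo 1 = Real.log 2 := by simp [biasInfo]

lemma biasInfo_neg (x : ℝ) : biasInfo (-x) = biasInfo x := by
  unfold biasInfo
  rw [← Real.binEntropy_one_sub]
  ring_nf

lemma biasInfo_abs (x : ℝ) : biasInfo |x| = biasInfo x := by
  rcases abs_choice x with h | h <;> rw [h]
  exact biasInfo_neg x

lemma biasInfo_nonneg (x : ℝ) : 0 ≤ biasInfo x := sub_nonneg.2 Real.binEntropy_le_log_two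

lemma biasInfo_strictMonoOn : StrictMonoOn biasInfo (Set.Icc 0 1) := by
  intro x hx y hy hxy
  have := Real.binEntropy_strictMonoOn (a := (1 - y) / 2) (b := (1 - x) / 2)
    ⟨by linarith [hy.2], by linarith [hy.1]⟩ ⟨by linarith [hx.2], by linarith [hx.1]⟩ (by linarith)
  unfold biasInfo
  linarith

/-- `biasInfo x` equals `log (1 - x ^ 2) / 2 + (x / 2) (log (1 + x) - log (1 - x))`. Both
logarithmic series are known, and `1 / (2k + 1) - 1 / (2k + 2)` is `biasCoeff k`. -/
lemma hasSum_biasInfo_of_abs_lt {x : ℝ} (hx : |x| < 1) :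
    HasSum (fun k => biasCoeff k * x ^ (2 * k + 2)) (biasInfo x) := by
  have hx' := abs_lt.1 hx
  have hsq : |x ^ 2| < 1 := by
    rw [abs_pow]; exact pow_lt_one₀ (abs_nonneg x) hx two_ne_zero
  have h1 := (Real.hasSum_pow_div_log_of_abs_lt_one hsq).mul_left (-(1 / 2))
  have h2 := (Real.hasSum_log_sub_log_of_abs_lt_one hx).mul_left (x / 2)
  have h12 := h1.add h2
  convert! h12 using 1
  · funext k
    unfold biasCoeff
    have : (2 * (k : ℝ) + 1) ≠ 0 := by positivity
    have : ((k : ℝ) + 1) ≠ 0 := by positivity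
    rw [← pow_mul]
    field_simp
    ring
  · have e1 : (1 - x ^ 2) = (1 + x) * (1 - x) := by ring
    have p1 : 0 < 1 + x := by linarith
    have p2 : 0 < 1 - x := by linarith
    have e2 : 1 - (1 - x) / 2 = (1 + x) / 2 := by ring
    rw [e1, Real.log_mul p1.ne' p2.ne', biasInfo, Real.binEntropy_eq_negMulLog_add_negMulLog_one_sub,
      e2, Real.negMulLog, Real.negMulLog, Real.log_div p1.ne' two_ne_zero,
      Real.log_div p2.ne' two_ne_zero]
    ring

lemma summable_biasCoeff : Summable biasCoeff := by
  have h : Summable fun k : ℕ => 1 / ((k + 1 : ℕ) : ℝ) ^ 2 :=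
    (summable_nat_add_iff 1).2 (Real.summable_one_div_nat_pow.2 one_lt_two)
  refine h.of_nonneg_of_le biasCoeff_nonneg fun k => ?_
  unfold biasCoeff
  push_cast
  gcongr
  nlinarith [(Nat.cast_nonneg k : (0 : ℝ) ≤ k)]

lemma hasSum_biasInfo {x : ℝ} (hx : |x| ≤ 1) :
    HasSum (fun k => biasCoeff k * x ^ (2 * k + 2)) (biasInfo x) := by
  have hb : ∀ (k : ℕ) (y : ℝ), |y| ≤ 1 → ‖biasCoeff k * y ^ (2 * k + 2)‖ ≤ biasCoeff k := by
    intro k y hy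
    rw [norm_mul, Real.norm_of_nonneg (biasCoeff_nonneg k), norm_pow]
    exact mul_le_of_le_one_right (biasCoeff_nonneg k) (pow_le_one₀ (norm_nonneg y) hy)
  have hs : Summable (fun k => biasCoeff k * x ^ (2 * k + 2)) :=
    Summable.of_norm_bounded summable_biasCoeff fun k => hb k x hx
  have hc : ContinuousOn (fun y : ℝ => ∑' k, biasCoeff k * y ^ (2 * k + 2)) (Set.Icc (-1) 1) :=
    continuousOn_tsum (fun k => by fun_prop) summable_biasCoeff
      fun k y hy => hb k y (abs_le.2 hy)
  have he : Set.EqOn (fun y : ℝ => ∑' k, biasCoeff k * y ^ (2 * k + 2)) biasInfo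
      (Set.Ioo (-1) 1) := fun y hy => (hasSum_biasInfo_of_abs_lt (abs_lt.2 hy)).tsum_eq
  -- Both sides are continuous on the closed interval, the series by the M-test, so the identity
  -- passes to the endpoints `±1`.
  have he' := he.of_subset_closure hc continuous_biasInfo.continuousOn Set.Ioo_subset_Icc_self
    (by rw [closure_Ioo (by norm_num)])
  rw [← he' (abs_le.1 hx)]
  exact hs.hasSum

/-! ### Product inequalities and convexity -/

/-- Chebyshev's sum inequality with weights. -/
lemma sum_mul_sum_le_of_monovary {s : Finset ℕ} {c f g : ℕ → ℝ} (hc : ∀ i, 0 ≤ c i)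
    (hfg : ∀ i j, 0 ≤ (f i - f j) * (g i - g j)) :
    (∑ i ∈ s, c i * f i) * (∑ i ∈ s, c i * g i) ≤
      (∑ i ∈ s, c i) * ∑ i ∈ s, c i * (f i * g i) := by
  have h : 0 ≤ ∑ i ∈ s, ∑ j ∈ s, c i * c j * ((f i - f j) * (g i - g j)) :=
    Finset.sum_nonneg fun i _ => Finset.sum_nonneg fun j _ =>
      mul_nonneg (mul_nonneg (hc i) (hc j)) (hfg i j)
  have e : ∑ i ∈ s, ∑ j ∈ s, c i * c j * ((f i - f j) * (g i - g j)) =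
      2 * ((∑ i ∈ s, c i) * ∑ i ∈ s, c i * (f i * g i)) -
        2 * ((∑ i ∈ s, c i * f i) * (∑ i ∈ s, c i * g i)) := by
    have e1 : (∑ i ∈ s, c i) * ∑ i ∈ s, c i * (f i * g i) =
        ∑ i ∈ s, ∑ j ∈ s, c i * (c j * (f j * g j)) := Finset.sum_mul_sum ..
    have e2 : (∑ i ∈ s, c i) * ∑ i ∈ s, c i * (f i * g i) =
        ∑ i ∈ s, ∑ j ∈ s, c i * (f i * g i) * c j := by rw [mul_comm, Finset.sum_mul_sum]
    have e3 : (∑ i ∈ s, c i * f i) * (∑ i ∈ s, c i * g i) =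
        ∑ i ∈ s, ∑ j ∈ s, c i * f i * (c j * g j) := Finset.sum_mul_sum ..
    have e4 : (∑ i ∈ s, c i * f i) * (∑ i ∈ s, c i * g i) =
        ∑ i ∈ s, ∑ j ∈ s, c i * g i * (c j * f j) := by rw [mul_comm, Finset.sum_mul_sum]
    rw [two_mul, two_mul]
    nth_rewrite 1 [e1]
    rw [e2]
    nth_rewrite 1 [e3]
    rw [e4]
    simp only [← Finset.sum_add_distrib, ← Finset.sum_sub_distrib]
    exact Finset.sum_congr rfl fun i _ => Finset.sum_congr rfl fun j _ => by ring
  linarith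

/-- The sequences `x ^ (2k + 2)` and `y ^ (2k + 2)` both decrease in `k`, so Chebyshev's inequality
with weights `biasCoeff` applies to the partial sums. The total weight `biasInfo 1` is `log 2`. -/
lemma biasInfo_mul_le {x y : ℝ} (hx : |x| ≤ 1) (hy : |y| ≤ 1) :
    biasInfo x * biasInfo y ≤ Real.log 2 * biasInfo (x * y) := by
  have hxy : |x * y| ≤ 1 := by rw [abs_mul]; exact mul_le_one₀ hx (abs_nonneg y) hy
  have h1 := (hasSum_biasInfo (x := 1) (by simp)).tendsto_sum_nat
  have h2 := (hasSum_biasInfo hxy).tendsto_sum_nat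
  have h3 := (hasSum_biasInfo hx).tendsto_sum_nat
  have h4 := (hasSum_biasInfo hy).tendsto_sum_nat
  rw [biasInfo_one] at h1
  refine le_of_tendsto_of_tendsto' (h3.mul h4) (h1.mul h2) fun N => ?_
  simp only [one_pow, mul_one, mul_pow]
  refine sum_mul_sum_le_of_monovary biasCoeff_nonneg fun i j => ?_
  have key : ∀ z : ℝ, |z| ≤ 1 → ∀ i j : ℕ, i ≤ j → z ^ (2 * j + 2) ≤ z ^ (2 * i + 2) := by
    intro z hz i j hij
    have e : ∀ k : ℕ, z ^ (2 * k + 2) = (|z| ^ 2) ^ (k + 1) := fun k => by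
      rw [sq_abs, ← pow_mul]; ring_nf
    rw [e, e]
    exact pow_le_pow_of_le_one (by positivity) (pow_le_one₀ (abs_nonneg z) hz) (by omega)
  rcases le_total i j with h | h
  · exact mul_nonneg (sub_nonneg.2 (key x hx i j h)) (sub_nonneg.2 (key y hy i j h))
  · exact mul_nonneg_of_nonpos_of_nonpos (sub_nonpos.2 (key x hx j i h))
      (sub_nonpos.2 (key y hy j i h))

/-- Termwise: every power `y ^ (2k + 2)` in the series is at most `y ^ 2`. -/
lemma biasInfo_mul_le_sq_mul {x y : ℝ} (hx : |x| ≤ 1) (hy : |y| ≤ 1) :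
    biasInfo (x * y) ≤ y ^ 2 * biasInfo x := by
  have hxy : |x * y| ≤ 1 := by rw [abs_mul]; exact mul_le_one₀ hx (abs_nonneg y) hy
  refine hasSum_le (fun k => ?_) (hasSum_biasInfo hxy) ((hasSum_biasInfo hx).mul_left (y ^ 2))
  have h1 : (y ^ 2) ^ k ≤ 1 := pow_le_one₀ (sq_nonneg y) (by
    rw [← sq_abs]; exact pow_le_one₀ (abs_nonneg y) hy)
  have h2 : 0 ≤ biasCoeff k * (x ^ (k + 1)) ^ 2 * y ^ 2 :=
    mul_nonneg (mul_nonneg (biasCoeff_nonneg k) (sq_nonneg _)) (sq_nonneg _)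
  calc biasCoeff k * (x * y) ^ (2 * k + 2)
      = biasCoeff k * (x ^ (k + 1)) ^ 2 * y ^ 2 * (y ^ 2) ^ k := by ring
    _ ≤ biasCoeff k * (x ^ (k + 1)) ^ 2 * y ^ 2 := mul_le_of_le_one_right h2 h1
    _ = _ := by ring

lemma hasSum_biasInfo_sqrt {s : ℝ} (hs : s ∈ Set.Icc (0 : ℝ) 1) :
    HasSum (fun k => biasCoeff k * s ^ (k + 1)) (biasInfo (√s)) := by
  have h := hasSum_biasInfo (x := √s) (by
    rw [abs_of_nonneg (Real.sqrt_nonneg s)]; exact Real.sqrt_le_one.2 hs.2)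
  convert h using 2 with k
  rw [show 2 * k + 2 = 2 * (k + 1) by ring, pow_mul, Real.sq_sqrt hs.1]

/-- In the variable `s = x ^ 2` the series is a nonnegative combination of the convex powers `s ^ (k
+ 1)`. -/
lemma convexOn_biasInfo_sqrt : ConvexOn ℝ (Set.Icc 0 1) fun s => biasInfo (√s) := by
  refine ⟨convex_Icc 0 1, fun x hx y hy a b ha hb hab => ?_⟩
  have hxy := convex_Icc (0 : ℝ) 1 hx hy ha hb hab
  simp only [smul_eq_mul] at hxy ⊢
  refine hasSum_le (fun k => ?_) (hasSum_biasInfo_sqrt hxy)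
    (((hasSum_biasInfo_sqrt hx).mul_left a).add ((hasSum_biasInfo_sqrt hy).mul_left b))
  have := (convexOn_pow (k + 1)).2 (x := x) (y := y) hx.1 hy.1 ha hb hab
  simp only [smul_eq_mul] at this
  nlinarith [mul_le_mul_of_nonneg_left this (biasCoeff_nonneg k)]

/-! ### The inverse entropy and `eta` -/

lemma h_hInv {s : ℝ} (hs : s ∈ Set.Icc (0 : ℝ) 1) :
    hInv s ∈ Set.Icc (0 : ℝ) (1 / 2) ∧ h (hInv s) = s := by
  have hl : 0 < Real.log 2 := Real.log_pos one_lt_two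
  have hc : ContinuousOn h (Set.Icc 0 (1 / 2)) :=
    (Real.binEntropy_continuous.div_const _).continuousOn
  have hmem : s ∈ h '' Set.Icc (0 : ℝ) (1 / 2) := by
    refine intermediate_value_Icc (by norm_num) hc ?_
    have h0 : h 0 = 0 := by simp [h]
    have h1 : h (1 / 2) = 1 := by
      rw [one_div, h, Real.binEntropy_two_inv, div_self hl.ne']
    rwa [h0, h1]
  exact ⟨Function.invFunOn_mem hmem, Function.invFunOn_eq hmem⟩

/-- `√(eta t)` is the bias `1 - 2 h⁻¹(1 - t)` of the binary symmetric channel of capacity `t`. -/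
lemma biasInfo_sqrt_eta {t : ℝ} (ht : t ∈ Set.Icc (0 : ℝ) 1) :
    biasInfo (√(eta t)) = t * Real.log 2 := by
  obtain ⟨h1, h2⟩ := h_hInv (s := 1 - t) ⟨by linarith [ht.2], by linarith [ht.1]⟩
  have hl : 0 < Real.log 2 := Real.log_pos one_lt_two
  rw [eta, Real.sqrt_sq (by linarith [h1.2]), biasInfo]
  rw [h, div_eq_iff hl.ne'] at h2
  rw [show (1 - (1 - 2 * hInv (1 - t))) / 2 = hInv (1 - t) by ring, h2]
  ring

lemma eta_mem_Icc {t : ℝ} (ht : t ∈ Set.Icc (0 : ℝ) 1) : eta t ∈ Set.Icc (0 : ℝ) 1 := by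
  obtain ⟨h1, -⟩ := h_hInv (s := 1 - t) ⟨by linarith [ht.2], by linarith [ht.1]⟩
  exact ⟨sq_nonneg _, pow_le_one₀ (by linarith [h1.2]) (by linarith [h1.1])⟩


/-! ### Products of binary symmetric channels -/

/-- The crossover probability `1 / 2`. -/
def half : I := ⟨1 / 2, by norm_num, by norm_num⟩

lemma coe_half : (half : ℝ) = 1 / 2 := rfl

/-- The probability that the noise bit of a binary symmetric channel with crossover probability
`a` equals `z`. -/
def flipProb (z : ZMod 2) (a : I) : ℝ := if z = 0 then 1 - (a : ℝ) else a

lemma zmod_two_cases (z : ZMod 2) : z = 0 ∨ z = 1 := by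
  revert z; decide

lemma flipProb_nonneg (z : ZMod 2) (a : I) : 0 ≤ flipProb z a := by
  unfold flipProb
  split_ifs
  · exact sub_nonneg.2 a.2.2
  · exact a.2.1

@[fun_prop]
lemma continuous_flipProb (z : ZMod 2) : Continuous (flipProb z) := by
  unfold flipProb
  split_ifs <;> fun_prop

lemma sum_flipProb (a : I) : ∑ z, flipProb z a = 1 := by
  rw [show (Finset.univ : Finset (ZMod 2)) = {0, 1} by decide, Finset.sum_pair zero_ne_one]
  simp [flipProb]

lemma flipProb_half (z : ZMod 2) : flipProb z half = 1 / 2 := by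
  unfold flipProb
  split_ifs <;> norm_num [coe_half]

lemma flipProb_eq (z : ZMod 2) (a : I) :
    flipProb z a = (1 - a) * flipProb z 0 + a * flipProb (z + 1) 0 := by
  rcases zmod_two_cases z with rfl | rfl <;> simp [flipProb, CharTwo.add_self_eq_zero]

variable {ι : Type*} [Fintype ι] [DecidableEq ι]

lemma sum_prod_flipProb (a : ι → I) (x : ι → ZMod 2) :
    ∑ y : ι → ZMod 2, ∏ i, flipProb (y i - x i) (a i) = 1 := by
  rw [← Fintype.prod_sum fun i z => flipProb (z - x i) (a i)]
  refine Finset.prod_eq_one fun i _ => ?_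
  rw [← sum_flipProb (a i)]
  exact Equiv.sum_comp (Equiv.subRight (x i)) fun z => flipProb z (a i)

/-- The output law of the product of the binary symmetric channels with crossover probabilities
`a i` for an input of law `p`. -/
def outPMF (p : (ι → ZMod 2) → ℝ) (a : ι → I) (y : ι → ZMod 2) : ℝ :=
  ∑ x, p x * ∏ i, flipProb (y i - x i) (a i)

/-- The mutual information (in nats) between an input of law `p` and the output of the product of
the binary symmetric channels with crossover probabilities `a i`. -/
def outInfo (p : (ι → ZMod 2) → ℝ) (a : ι → I) : ℝ :=
  ∑ y, Real.negMulLog (outPMF p a y) - ∑ i, Real.binEntropy (a i)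

lemma outPMF_nonneg {p : (ι → ZMod 2) → ℝ} (hp : ∀ x, 0 ≤ p x) (a : ι → I) (y : ι → ZMod 2) :
    0 ≤ outPMF p a y :=
  Finset.sum_nonneg fun x _ => mul_nonneg (hp x) (Finset.prod_nonneg fun _ _ => flipProb_nonneg _ _)

lemma sum_outPMF {p : (ι → ZMod 2) → ℝ} (hp : ∑ x, p x = 1) (a : ι → I) :
    ∑ y, outPMF p a y = 1 := by
  unfold outPMF
  rw [Finset.sum_comm]
  simp only [← Finset.mul_sum, sum_prod_flipProb, mul_one, hp]

@[fun_prop]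
lemma continuous_outPMF (p : (ι → ZMod 2) → ℝ) (y : ι → ZMod 2) :
    Continuous fun a => outPMF p a y := by
  unfold outPMF; fun_prop

lemma continuous_outInfo (p : (ι → ZMod 2) → ℝ) : Continuous (outInfo p) := by
  unfold outInfo
  refine Continuous.sub ?_ ?_
  · exact continuous_finsetSum _ fun y _ => Real.continuous_negMulLog.comp (continuous_outPMF p y)
  · exact continuous_finsetSum _ fun i _ => Real.binEntropy_continuous.comp (by fun_prop)

lemma add_single_add_single {κ : Type*} [DecidableEq κ] (y : κ → ZMod 2) (i : κ) :
    y + Pi.single i 1 + Pi.single i 1 = y := by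
  rw [add_assoc, ← Pi.single_add, CharTwo.add_self_eq_zero, Pi.single_zero, add_zero]

lemma sum_add_single (F : (ι → ZMod 2) → ℝ) (i : ι) :
    ∑ y : ι → ZMod 2, F (y + Pi.single i 1) = ∑ y, F y :=
  Equiv.sum_comp (Equiv.addRight (Pi.single i 1)) F

lemma sum_eq_half_sum_pair (F : (ι → ZMod 2) → ℝ) (i : ι) :
    ∑ y, F y = 1 / 2 * ∑ y, (F y + F (y + Pi.single i 1)) := by
  rw [Finset.sum_add_distrib, sum_add_single]; ring

/-- The output law is affine in each crossover: the noise at `i` either leaves the noiseless output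
alone or flips its `i`-th bit. -/
lemma outPMF_update (p : (ι → ZMod 2) → ℝ) (a : ι → I) (i : ι) (s : I) (y : ι → ZMod 2) :
    outPMF p (Function.update a i s) y =
      (1 - s) * outPMF p (Function.update a i 0) y +
        s * outPMF p (Function.update a i 0) (y + Pi.single i 1) := by
  unfold outPMF
  rw [Finset.mul_sum, Finset.mul_sum, ← Finset.sum_add_distrib]
  refine Finset.sum_congr rfl fun x _ => ?_
  have e : ∀ (s : I) (z : ι → ZMod 2), (∀ j ≠ i, z j = y j) →
      ∏ j, flipProb (z j - x j) (Function.update a i s j) =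
        flipProb (z i - x i) s * ∏ j ∈ Finset.univ.erase i, flipProb (y j - x j) (a j) := by
    intro s z hz
    rw [← Finset.mul_prod_erase _ _ (Finset.mem_univ i), Function.update_self]
    congr 1
    refine Finset.prod_congr rfl fun j hj => ?_
    rw [Function.update_of_ne (Finset.ne_of_mem_erase hj), hz j (Finset.ne_of_mem_erase hj)]
  rw [e s y fun _ _ => rfl, e 0 y fun _ _ => rfl, e 0 (y + Pi.single i 1) fun j hj => by simp [hj],
    flipProb_eq _ s, Pi.add_apply, Pi.single_eq_same, add_sub_right_comm]
  ring

/-! ### Information gained from one output -/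

/-- The output law restricted to the coordinates other than `i`, jointly with the `i`-th input
bit. -/
def edgeProb (p : (ι → ZMod 2) → ℝ) (a : ι → I) (i : ι) (y : ι → ZMod 2) : ℝ :=
  outPMF p (Function.update a i 0) y

/-- The probability of the outputs at the coordinates other than `i`. -/
def edgeMass (p : (ι → ZMod 2) → ℝ) (a : ι → I) (i : ι) (y : ι → ZMod 2) : ℝ :=
  edgeProb p a i y + edgeProb p a i (y + Pi.single i 1)

/-- The signed bias of the `i`-th input bit given the outputs at the other coordinates. -/
def edgeBias (p : (ι → ZMod 2) → ℝ) (a : ι → I) (i : ι) (y : ι → ZMod 2) : ℝ :=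
  (edgeProb p a i y - edgeProb p a i (y + Pi.single i 1)) / edgeMass p a i y

/-- The mean squared bias of the `i`-th input bit given the outputs at the other coordinates. -/
def meanSqBias (p : (ι → ZMod 2) → ℝ) (i : ι) (a : ι → I) : ℝ :=
  1 / 2 * ∑ y, edgeMass p a i y * edgeBias p a i y ^ 2

lemma edgeProb_nonneg {p : (ι → ZMod 2) → ℝ} (hp : ∀ x, 0 ≤ p x) (a : ι → I) (i : ι)
    (y : ι → ZMod 2) : 0 ≤ edgeProb p a i y := outPMF_nonneg hp _ _

lemma edgeMass_nonneg {p : (ι → ZMod 2) → ℝ} (hp : ∀ x, 0 ≤ p x) (a : ι → I) (i : ι)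
    (y : ι → ZMod 2) : 0 ≤ edgeMass p a i y :=
  add_nonneg (edgeProb_nonneg hp a i y) (edgeProb_nonneg hp a i _)

lemma abs_edgeBias_le_one {p : (ι → ZMod 2) → ℝ} (hp : ∀ x, 0 ≤ p x) (a : ι → I) (i : ι)
    (y : ι → ZMod 2) : |edgeBias p a i y| ≤ 1 := by
  have h1 := edgeProb_nonneg hp a i y
  have h2 := edgeProb_nonneg hp a i (y + Pi.single i 1)
  rw [edgeBias, abs_div, abs_of_nonneg (edgeMass_nonneg hp a i y)]
  refine div_le_one_of_le₀ ?_ (edgeMass_nonneg hp a i y)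
  rw [edgeMass, abs_le]
  constructor <;> linarith

lemma sum_edgeMass {p : (ι → ZMod 2) → ℝ} (hp : ∑ x, p x = 1) (a : ι → I) (i : ι) :
    ∑ y, edgeMass p a i y = 2 := by
  unfold edgeMass
  rw [Finset.sum_add_distrib, sum_add_single]
  unfold edgeProb
  rw [sum_outPMF hp]
  norm_num

/-- Grouping rule for the entropy: the pair has mass `r + r'`, and within it the conditional law has
bias `(1 - 2s) (r - r') / (r + r')`, because a binary symmetric channel multiplies biases by `1 -
2s`. For `r + r' = 0` both masses vanish and the default value of the quotient is harmless. -/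
lemma negMulLog_add_negMulLog_mix {r r' s : ℝ} (hr : 0 ≤ r) (hr' : 0 ≤ r') :
    Real.negMulLog ((1 - s) * r + s * r') + Real.negMulLog ((1 - s) * r' + s * r) =
      Real.negMulLog (r + r') +
        (r + r') * (Real.log 2 - biasInfo ((1 - 2 * s) * ((r - r') / (r + r')))) := by
  rcases eq_or_ne (r + r') 0 with h0 | h0
  · have : r = 0 := by linarith
    have : r' = 0 := by linarith
    simp [*]
  · set u := (1 - (1 - 2 * s) * ((r - r') / (r + r'))) / 2 with hu
    have e1 : (1 - s) * r + s * r' = (r + r') * (1 - u) := by rw [hu]; field_simp; ring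
    have e2 : (1 - s) * r' + s * r = (r + r') * u := by rw [hu]; field_simp; ring
    rw [e1, e2, Real.negMulLog_mul, Real.negMulLog_mul, biasInfo, ← hu,
      Real.binEntropy_eq_negMulLog_add_negMulLog_one_sub]
    ring

lemma sum_negMulLog_outPMF_update {p : (ι → ZMod 2) → ℝ} (hp : ∀ x, 0 ≤ p x)
    (a : ι → I) (i : ι) (s : I) :
    ∑ y, Real.negMulLog (outPMF p (Function.update a i s) y) =
      1 / 2 * ∑ y, (Real.negMulLog (edgeMass p a i y) + edgeMass p a i y *
        (Real.log 2 - biasInfo ((1 - 2 * s) * edgeBias p a i y))) := by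
  rw [sum_eq_half_sum_pair _ i]
  congr 1
  refine Finset.sum_congr rfl fun y _ => ?_
  rw [outPMF_update, outPMF_update p a i s (y + _), add_single_add_single]
  exact negMulLog_add_negMulLog_mix (edgeProb_nonneg hp a i y) (edgeProb_nonneg hp a i _)

lemma sum_binEntropy_update (a : ι → I) (i : ι) (s : I) :
    ∑ j, Real.binEntropy (Function.update a i s j) =
      Real.binEntropy s + ∑ j ∈ Finset.univ.erase i, Real.binEntropy (a j) := by
  rw [← Finset.add_sum_erase _ _ (Finset.mem_univ i), Function.update_self]
  congr 1
  exact Finset.sum_congr rfl fun j hj => by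
    rw [Function.update_of_ne (Finset.ne_of_mem_erase hj)]

/-- The information gained from observing the `i`-th output. -/
lemma outInfo_update_sub {p : (ι → ZMod 2) → ℝ} (hp : ∀ x, 0 ≤ p x) (hp1 : ∑ x, p x = 1)
    (a : ι → I) (i : ι) (s : I) :
    outInfo p (Function.update a i s) - outInfo p (Function.update a i half) =
      1 / 2 * ∑ y, edgeMass p a i y *
        (biasInfo (1 - 2 * s) - biasInfo ((1 - 2 * s) * edgeBias p a i y)) := by
  have hm := sum_edgeMass hp1 a i
  unfold outInfo
  rw [sum_negMulLog_outPMF_update hp, sum_negMulLog_outPMF_update hp, sum_binEntropy_update,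
    sum_binEntropy_update, coe_half]
  have e1 : Real.binEntropy (s : ℝ) = Real.log 2 - biasInfo (1 - 2 * s) := by
    rw [biasInfo]; ring_nf
  have e2 : Real.binEntropy (1 / 2) = Real.log 2 := by rw [one_div, Real.binEntropy_two_inv]
  rw [e1, e2]
  -- The entropy of the other outputs occurs in both terms and cancels. At `half` the bias factor `1
  -- - 2s` is zero.
  simp only [mul_sub, mul_one_div_cancel (two_ne_zero' ℝ), sub_self, zero_mul, biasInfo_zero,
    mul_zero, Finset.sum_add_distrib, Finset.sum_sub_distrib, ← Finset.sum_mul, hm,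
    Finset.sum_const_zero]
  ring

lemma outInfo_update_zero_sub {p : (ι → ZMod 2) → ℝ} (hp : ∀ x, 0 ≤ p x) (hp1 : ∑ x, p x = 1)
    (a : ι → I) (i : ι) :
    outInfo p (Function.update a i 0) - outInfo p (Function.update a i half) =
      1 / 2 * ∑ y, edgeMass p a i y * (Real.log 2 - biasInfo (edgeBias p a i y)) := by
  rw [outInfo_update_sub hp hp1]
  simp [biasInfo_one]

lemma abs_one_sub_two_mul_le_one (s : I) : |1 - 2 * (s : ℝ)| ≤ 1 := by
  rw [abs_le]
  constructor <;> linarith [s.2.1, s.2.2]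

/-- By `biasInfo_mul_le`, applied to each outcome of the other outputs. The right side is the
average over an erasure channel of capacity `biasInfo (1 - 2s) / log 2`. -/
lemma outInfo_update_le {p : (ι → ZMod 2) → ℝ} (hp : ∀ x, 0 ≤ p x) (hp1 : ∑ x, p x = 1)
    (a : ι → I) (i : ι) (s : I) :
    outInfo p (Function.update a i s) ≤ outInfo p (Function.update a i half) +
      biasInfo (1 - 2 * s) / Real.log 2 *
        (outInfo p (Function.update a i 0) - outInfo p (Function.update a i half)) := by
  have hl : 0 < Real.log 2 := Real.log_pos one_lt_two
  rw [← sub_le_iff_le_add', outInfo_update_sub hp hp1, outInfo_update_zero_sub hp hp1,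
    mul_left_comm, Finset.mul_sum _ _ (biasInfo (1 - 2 * (s : ℝ)) / Real.log 2)]
  refine mul_le_mul_of_nonneg_left (Finset.sum_le_sum fun y _ => ?_) (by norm_num)
  rw [mul_left_comm]
  refine mul_le_mul_of_nonneg_left ?_ (edgeMass_nonneg hp a i y)
  have := biasInfo_mul_le (abs_one_sub_two_mul_le_one s) (abs_edgeBias_le_one hp a i y)
  rw [div_mul_eq_mul_div, le_div_iff₀ hl]
  linarith

/-- By `biasInfo_mul_le_sq_mul`, applied to each outcome. The bound separates `s` from the other
coordinates, which enter only through `meanSqBias`. -/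
lemma le_outInfo_update_sub {p : (ι → ZMod 2) → ℝ} (hp : ∀ x, 0 ≤ p x) (hp1 : ∑ x, p x = 1)
    (a : ι → I) (i : ι) (s : I) :
    biasInfo (1 - 2 * s) * (1 - meanSqBias p i a) ≤
      outInfo p (Function.update a i s) - outInfo p (Function.update a i half) := by
  rw [outInfo_update_sub hp hp1]
  have h1 : (1 : ℝ) = 1 / 2 * ∑ y, edgeMass p a i y := by rw [sum_edgeMass hp1]; norm_num
  unfold meanSqBias
  nth_rewrite 2 [h1]
  rw [← mul_sub, ← Finset.sum_sub_distrib, mul_left_comm, Finset.mul_sum]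
  refine mul_le_mul_of_nonneg_left (Finset.sum_le_sum fun y _ => ?_) (by norm_num)
  have := mul_le_mul_of_nonneg_left (biasInfo_mul_le_sq_mul (abs_one_sub_two_mul_le_one s)
    (abs_edgeBias_le_one hp a i y)) (edgeMass_nonneg hp a i y)
  linarith

lemma meanSqBias_nonneg {p : (ι → ZMod 2) → ℝ} (hp : ∀ x, 0 ≤ p x) (a : ι → I) (i : ι) :
    0 ≤ meanSqBias p i a :=
  mul_nonneg (by norm_num) (Finset.sum_nonneg fun y _ =>
    mul_nonneg (edgeMass_nonneg hp a i y) (sq_nonneg _))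

lemma meanSqBias_le_one {p : (ι → ZMod 2) → ℝ} (hp : ∀ x, 0 ≤ p x) (hp1 : ∑ x, p x = 1)
    (a : ι → I) (i : ι) : meanSqBias p i a ≤ 1 := by
  have h1 : (1 : ℝ) = 1 / 2 * ∑ y, edgeMass p a i y := by rw [sum_edgeMass hp1]; norm_num
  rw [h1, meanSqBias]
  refine mul_le_mul_of_nonneg_left (Finset.sum_le_sum fun y _ => ?_) (by norm_num)
  refine mul_le_of_le_one_right (edgeMass_nonneg hp a i y) ?_
  rw [← sq_abs]
  exact pow_le_one₀ (abs_nonneg _) (abs_edgeBias_le_one hp a i y)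

lemma measurable_meanSqBias (p : (ι → ZMod 2) → ℝ) (i : ι) : Measurable (meanSqBias p i) := by
  have h : ∀ y, Measurable fun a => edgeProb p a i y := fun y =>
    ((continuous_outPMF p y).comp (continuous_id.update i continuous_const)).measurable
  unfold meanSqBias edgeBias edgeMass
  exact (Finset.measurable_fun_sum _ fun y _ => ((h _).add (h _)).mul
    ((((h _).sub (h _)).div ((h _).add (h _))).pow_const 2)).const_mul _

lemma meanSqBias_update_self (p : (ι → ZMod 2) → ℝ) (i : ι) (a : ι → I) (s : I) :
    meanSqBias p i (Function.update a i s) = meanSqBias p i a := by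
  simp [meanSqBias, edgeMass, edgeBias, edgeProb]

/-- If the input is uniform on a coset, then for erasures the residual bit is determined or
uniform. -/
lemma outInfo_update_zero_sub_of_coset {p : (ι → ZMod 2) → ℝ} (hp : ∀ x, 0 ≤ p x)
    (hp1 : ∑ x, p x = 1) (hC : ∀ x x', p x ≠ 0 → p x' ≠ 0 → ∀ z, p (z + (x' - x)) = p z)
    {a : ι → I} (ha : ∀ j, a j = 0 ∨ a j = half) (i : ι) :
    outInfo p (Function.update a i 0) - outInfo p (Function.update a i half) =
      Real.log 2 * (1 - meanSqBias p i a) := by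
  have hb : ∀ y, edgeProb p a i y = 0 ∨ edgeProb p a i (y + Pi.single i 1) = 0 ∨
      edgeProb p a i y = edgeProb p a i (y + Pi.single i 1) := by
    intro y
    by_contra! hcon
    obtain ⟨h1, h2, h3⟩ := hcon
    -- A possible output comes from a possible input that agrees with it on the noiseless
    -- coordinates.
    have key : ∀ z, edgeProb p a i z ≠ 0 → ∃ x, p x ≠ 0 ∧
        ∀ j, Function.update a i 0 j = 0 → x j = z j := by
      intro z hz
      obtain ⟨x, -, hx⟩ := Finset.exists_ne_zero_of_sum_ne_zero hz
      refine ⟨x, left_ne_zero_of_mul hx, fun j hj => ?_⟩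
      have := Finset.prod_ne_zero_iff.1 (right_ne_zero_of_mul hx) j (Finset.mem_univ j)
      rw [hj] at this
      by_contra hne
      have hne' : z j - x j ≠ 0 := sub_ne_zero.2 (Ne.symm hne)
      simp [flipProb, hne'] at this
    obtain ⟨x, hx, hxy⟩ := key _ h1
    obtain ⟨x', hx', hxy'⟩ := key _ h2
    apply h3
    unfold edgeProb outPMF
    -- Translation by `x' - x` preserves `p`. On the noiseless coordinates it coincides with
    -- `Pi.single i 1`; on the others the factors are constantly `1 / 2`. So two possible outcomes
    -- of the bit are equally likely.
    refine Eq.trans ?_ (Equiv.sum_comp (Equiv.addRight (x' - x)) _)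
    refine Finset.sum_congr rfl fun w _ => ?_
    simp only [Equiv.coe_addRight]
    rw [hC x x' hx hx']
    congr 1
    refine Finset.prod_congr rfl fun j _ => ?_
    have h01 : Function.update a i 0 j = 0 ∨ Function.update a i 0 j = half := by
      rcases eq_or_ne j i with rfl | hj
      · simp
      · rw [Function.update_of_ne hj]; exact ha j
    rcases h01 with h | h
    · have e1 := hxy j h
      have e2 := hxy' j h
      congr 1
      simp only [Pi.add_apply, Pi.sub_apply] at e2 ⊢
      rw [e1, e2]
      ring
    · rw [h, flipProb_half, flipProb_half]
  rw [outInfo_update_zero_sub hp hp1]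
  have h1 : (1 : ℝ) = 1 / 2 * ∑ y, edgeMass p a i y := by rw [sum_edgeMass hp1]; norm_num
  unfold meanSqBias
  nth_rewrite 2 [h1]
  rw [← mul_sub, ← Finset.sum_sub_distrib, mul_left_comm, Finset.mul_sum _ _ (Real.log 2)]
  congr 1
  refine Finset.sum_congr rfl fun y _ => ?_
  -- `biasInfo b = b ^ 2 * log 2` for `b = 0, ±1`, the only biases left by `hb`.
  have hy : edgeMass p a i y * biasInfo (edgeBias p a i y) =
      Real.log 2 * (edgeMass p a i y * edgeBias p a i y ^ 2) := by
    rcases eq_or_ne (edgeMass p a i y) 0 with h0 | h0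
    · simp [h0]
    rcases hb y with h | h | h
    · have : edgeBias p a i y = -1 := by
        rw [edgeBias, div_eq_iff h0, edgeMass, h]; ring
      rw [this, biasInfo_neg, biasInfo_one]; ring
    · have : edgeBias p a i y = 1 := by
        rw [edgeBias, div_eq_iff h0, edgeMass, h]; ring
      rw [this, biasInfo_one]; ring
    · have : edgeBias p a i y = 0 := by rw [edgeBias, h, sub_self, zero_div]
      rw [this, biasInfo_zero]; ring
  linear_combination -hy

/-! ### Mean squared bias as a function of another crossover -/

/-- The contribution to the mean squared bias of a pair of outputs that differ in one coordinate,
as a function of the crossover probability `s` at that coordinate. -/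
def pairSqBias (s S S' D D' : ℝ) : ℝ :=
  ((1 - s) * D + s * D') ^ 2 / ((1 - s) * S + s * S') +
    ((1 - s) * D' + s * D) ^ 2 / ((1 - s) * S' + s * S)

lemma pairSqBias_symm (s S S' D D' : ℝ) : pairSqBias s S S' D D' = pairSqBias s S' S D' D :=
  add_comm _ _

/-- If one output of the pair is impossible, the noise only splits the mass of the other one and
leaves its bias unchanged, so the value does not depend on `s`. -/
lemma pairSqBias_zero_left (s S' D' : ℝ) : pairSqBias s 0 S' 0 D' = D' ^ 2 / S' := by
  rcases eq_or_ne S' 0 with rfl | h0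
  · simp [pairSqBias]
  rcases eq_or_ne s 0 with rfl | hs
  · simp [pairSqBias]
  rcases eq_or_ne (1 - s) 0 with hs' | hs'
  · have : s = 1 := by linarith
    simp [pairSqBias, this]
  simp only [pairSqBias, mul_zero, zero_add, add_zero]
  field_simp
  ring

/-- The gap between the two sides is an explicit fraction made of squares, the factor `s * (1 - s)`
and a positive denominator. If `S` or `S'` vanishes, so does its `D`, and equality holds by
`pairSqBias_zero_left`. The weight depends on `s` only through `(1 - 2s) ^ 2`, hence only the mean
of that square matters after integration. -/
lemma pairSqBias_le {s S S' D D' : ℝ} (hs0 : 0 ≤ s) (hs1 : s ≤ 1) (hD : |D| ≤ S)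
    (hD' : |D'| ≤ S') :
    pairSqBias s S S' D D' ≤ (1 - 2 * s) ^ 2 * pairSqBias 0 S S' D D' +
        (1 - (1 - 2 * s) ^ 2) * pairSqBias (1 / 2) S S' D D' := by
  have hS := (abs_nonneg D).trans hD
  have hS' := (abs_nonneg D').trans hD'
  rcases hS.eq_or_lt with h | h
  · rw [← h] at hD ⊢
    obtain rfl := abs_eq_zero.1 (hD.antisymm (abs_nonneg D))
    simp only [pairSqBias_zero_left]
    apply le_of_eq; ring
  rcases hS'.eq_or_lt with h' | h'
  · rw [← h'] at hD' ⊢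
    obtain rfl := abs_eq_zero.1 (hD'.antisymm (abs_nonneg D'))
    simp only [pairSqBias_symm _ S 0, pairSqBias_zero_left]
    apply le_of_eq; ring
  have hA : 0 < (1 - s) * S + s * S' := by
    rcases hs0.eq_or_lt with rfl | hs
    · simpa using h
    · exact add_pos_of_nonneg_of_pos (mul_nonneg (by linarith) hS) (mul_pos hs h')
  have hA' : 0 < (1 - s) * S' + s * S := by
    rcases hs0.eq_or_lt with rfl | hs
    · simpa using h'
    · exact add_pos_of_nonneg_of_pos (mul_nonneg (by linarith) hS') (mul_pos hs h)
  have key : (1 - 2 * s) ^ 2 * pairSqBias 0 S S' D D' +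
      (1 - (1 - 2 * s) ^ 2) * pairSqBias (1 / 2) S S' D D' - pairSqBias s S S' D D' =
      (D * S' - D' * S) ^ 2 * (1 - 2 * s) ^ 2 * (S - S') ^ 2 * (s * (1 - s)) /
        ((S + S') * S * S' * ((1 - s) * S + s * S') * ((1 - s) * S' + s * S)) := by
    have e0 : pairSqBias 0 S S' D D' = D ^ 2 / S + D' ^ 2 / S' := by simp [pairSqBias]
    have e1 : pairSqBias (1 / 2) S S' D D' = (D + D') ^ 2 / (S + S') := by
      have : S + S' ≠ 0 := by positivity
      have : S' + S ≠ 0 := by positivity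
      norm_num [pairSqBias]
      rw [← mul_add, ← mul_add, ← mul_add, ← mul_add]
      field_simp
      ring
    rw [e0, e1, pairSqBias]
    have : S + S' ≠ 0 := by positivity
    generalize hAe : (1 - s) * S + s * S' = A at *
    generalize hAe' : (1 - s) * S' + s * S = A' at *
    field_simp
    rw [← hAe, ← hAe']
    ring
  have : 0 ≤ (D * S' - D' * S) ^ 2 * (1 - 2 * s) ^ 2 * (S - S') ^ 2 * (s * (1 - s)) /
        ((S + S') * S * S' * ((1 - s) * S + s * S') * ((1 - s) * S' + s * S)) := by
    have : 0 ≤ 1 - s := by linarith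
    positivity
  linarith

/-- Cauchy-Schwarz: `(D + D') ^ 2 / (S + S') ≤ D ^ 2 / S + D' ^ 2 / S'`. Erasing an output cannot
sharpen the bias. -/
lemma pairSqBias_half_le {S S' D D' : ℝ} (hD : |D| ≤ S) (hD' : |D'| ≤ S') :
    pairSqBias (1 / 2) S S' D D' ≤ pairSqBias 0 S S' D D' := by
  have hS := (abs_nonneg D).trans hD
  have hS' := (abs_nonneg D').trans hD'
  rcases hS.eq_or_lt with h | h
  · rw [← h] at hD ⊢
    obtain rfl := abs_eq_zero.1 (hD.antisymm (abs_nonneg D))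
    simp only [pairSqBias_zero_left]
    exact le_rfl
  rcases hS'.eq_or_lt with h' | h'
  · rw [← h'] at hD' ⊢
    obtain rfl := abs_eq_zero.1 (hD'.antisymm (abs_nonneg D'))
    simp only [pairSqBias_symm _ S 0, pairSqBias_zero_left]
    exact le_rfl
  have key : pairSqBias 0 S S' D D' - pairSqBias (1 / 2) S S' D D' =
      (D * S' - D' * S) ^ 2 / (S * S' * (S + S')) := by
    have : S + S' ≠ 0 := by positivity
    have : S' + S ≠ 0 := by positivity
    norm_num [pairSqBias]
    rw [← mul_add, ← mul_add, ← mul_add, ← mul_add]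
    field_simp
    ring
  have : 0 ≤ (D * S' - D' * S) ^ 2 / (S * S' * (S + S')) := by positivity
  linarith

lemma meanSqBias_update (p : (ι → ZMod 2) → ℝ) {i j : ι} (hij : i ≠ j) (a : ι → I) (s : I) :
    meanSqBias p i (Function.update a j s) = 1 / 4 * ∑ y, pairSqBias s
      (edgeMass p (Function.update a j 0) i y)
      (edgeMass p (Function.update a j 0) i (y + Pi.single j 1))
      (edgeProb p (Function.update a j 0) i y -
        edgeProb p (Function.update a j 0) i (y + Pi.single i 1))
      (edgeProb p (Function.update a j 0) i (y + Pi.single j 1) -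
        edgeProb p (Function.update a j 0) i (y + Pi.single j 1 + Pi.single i 1)) := by
  have hP : ∀ y, edgeProb p (Function.update a j s) i y =
      (1 - s) * edgeProb p (Function.update a j 0) i y +
        s * edgeProb p (Function.update a j 0) i (y + Pi.single j 1) := by
    intro y
    unfold edgeProb
    rw [Function.update_comm hij.symm, outPMF_update, Function.update_comm hij]
  unfold meanSqBias
  -- Pairing along `j` adds a second factor `1 / 2` to the one in `meanSqBias`.
  rw [sum_eq_half_sum_pair _ j, ← mul_assoc]
  norm_num only
  congr 1
  refine Finset.sum_congr rfl fun y _ => ?_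
  have hm : ∀ (b : ι → I) (z : ι → ZMod 2), edgeMass p b i z * edgeBias p b i z ^ 2 =
      (edgeProb p b i z - edgeProb p b i (z + Pi.single i 1)) ^ 2 / edgeMass p b i z := by
    intro b z
    rcases eq_or_ne (edgeMass p b i z) 0 with h0 | h0
    · simp [h0]
    · rw [edgeBias]; field_simp
  rw [hm, hm, pairSqBias]
  unfold edgeMass
  simp only [hP, add_single_add_single, add_right_comm _ (Pi.single j 1) (Pi.single i 1)]
  congr 2 <;> ring

lemma meanSqBias_update_le {p : (ι → ZMod 2) → ℝ} (hp : ∀ x, 0 ≤ p x) {i j : ι} (hij : i ≠ j)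
    (a : ι → I) (s : I) :
    meanSqBias p i (Function.update a j s) ≤
      (1 - 2 * s) ^ 2 * meanSqBias p i (Function.update a j 0) +
        (1 - (1 - 2 * s) ^ 2) * meanSqBias p i (Function.update a j half) ∧
    meanSqBias p i (Function.update a j half) ≤ meanSqBias p i (Function.update a j 0) := by
  have hD : ∀ y, |edgeProb p (Function.update a j 0) i y -
      edgeProb p (Function.update a j 0) i (y + Pi.single i 1)| ≤
      edgeMass p (Function.update a j 0) i y := fun y => by
    have h1 := edgeProb_nonneg hp (Function.update a j 0) i y
    have h2 := edgeProb_nonneg hp (Function.update a j 0) i (y + Pi.single i 1)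
    rw [edgeMass, abs_le]
    constructor <;> linarith
  rw [meanSqBias_update p hij a s, meanSqBias_update p hij a 0, meanSqBias_update p hij a half]
  constructor
  · have := Finset.sum_le_sum fun y (_ : y ∈ Finset.univ) =>
      pairSqBias_le s.2.1 s.2.2 (hD y) (hD (y + Pi.single j 1))
    rw [Finset.sum_add_distrib, ← Finset.mul_sum, ← Finset.mul_sum] at this
    rw [Set.Icc.coe_zero, coe_half]
    linarith
  · exact mul_le_mul_of_nonneg_left (Finset.sum_le_sum fun y _ =>
      pairSqBias_half_le (hD _) (hD _)) (by norm_num)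

/-- With every crossover equal to `half` the output is uniform whatever the input. -/
lemma outInfo_half {p : (ι → ZMod 2) → ℝ} (hp1 : ∑ x, p x = 1) :
    outInfo p (fun _ => half) = 0 := by
  have h : ∀ y, outPMF p (fun _ => half) y = (1 / 2) ^ Fintype.card ι := fun y => by
    simp only [outPMF, flipProb_half, Finset.prod_const, Finset.card_univ, ← Finset.sum_mul, hp1,
      one_mul]
  have e2 : Real.binEntropy (1 / 2) = Real.log 2 := by rw [one_div, Real.binEntropy_two_inv]
  simp only [outInfo, h, coe_half, e2, Finset.sum_const, Finset.card_univ, Fintype.card_fun,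
    ZMod.card, nsmul_eq_mul, Real.negMulLog, Real.log_pow, Nat.cast_pow]
  rw [one_div, Real.log_inv]
  have : ((2 : ℕ) : ℝ) ^ Fintype.card ι * (2⁻¹ : ℝ) ^ Fintype.card ι = 1 := by
    rw [← mul_pow]; norm_num
  linear_combination (Fintype.card ι * Real.log 2) * this


/-! ### Exchanging one coordinate of a product measure -/

section PiMeasure

variable {Ω : Type*} [MeasurableSpace Ω]

lemma integrable_of_measurable_of_bounded {α : Type*} [MeasurableSpace α] {μ : Measure α}
    [IsFiniteMeasure μ] {F : α → ℝ} (hF : Measurable F) {B : ℝ} (hB : ∀ a, |F a| ≤ B) :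
    Integrable F μ :=
  Integrable.of_bound hF.aestronglyMeasurable B (ae_of_all _ hB)

lemma measurable_update_prod {ι : Type*} [DecidableEq ι] {Ω : Type*} [MeasurableSpace Ω] (i : ι) :
    Measurable fun z : (ι → Ω) × Ω => Function.update z.1 i z.2 := by
  refine measurable_pi_lambda _ fun j => ?_
  rcases eq_or_ne j i with rfl | hj
  · simpa using measurable_snd
  · simp only [Function.update_of_ne hj]
    exact (measurable_pi_apply j).comp measurable_fst

/-- Resampling one coordinate of a product measure. -/
lemma map_update_prod_pi {ν ν' : ι → Measure Ω} [∀ i, IsProbabilityMeasure (ν i)]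
    [∀ i, IsProbabilityMeasure (ν' i)] (i : ι) (h : ∀ j ≠ i, ν' j = ν j) :
    ((Measure.pi ν).prod (ν' i)).map (fun z => Function.update z.1 i z.2) = Measure.pi ν' := by
  have hm := measurable_update_prod (Ω := Ω) i
  symm
  refine Measure.pi_eq fun s hs => ?_
  have hpre : (fun z : (ι → Ω) × Ω => Function.update z.1 i z.2) ⁻¹' Set.univ.pi s =
      (Set.univ.pi (Function.update s i Set.univ)) ×ˢ s i := by
    ext ⟨a, t⟩
    simp only [Set.mem_preimage, Set.mem_pi, Set.mem_univ, true_implies, Set.mem_prod]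
    constructor
    · intro H
      refine ⟨fun j => ?_, by simpa using H i⟩
      rcases eq_or_ne j i with rfl | hj
      · simp
      · simpa [Function.update_of_ne hj] using H j
    · rintro ⟨H, H'⟩ j
      rcases eq_or_ne j i with rfl | hj
      · simpa using H'
      · simpa [Function.update_of_ne hj] using H j
  rw [Measure.map_apply hm (.univ_pi hs), hpre, Measure.prod_prod, Measure.pi_pi,
    ← Finset.mul_prod_erase _ _ (Finset.mem_univ i),
    ← Finset.mul_prod_erase _ (fun j => ν' j (s j)) (Finset.mem_univ i)]
  simp only [Function.update_self, measure_univ, one_mul]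
  rw [mul_comm]
  congr 1
  refine Finset.prod_congr rfl fun j hj => ?_
  rw [Function.update_of_ne (Finset.ne_of_mem_erase hj), h j (Finset.ne_of_mem_erase hj)]

/-- Fubini after redrawing coordinate `i`. The case `ν' = ν` is also used, to isolate one coordinate
of a given product. -/
lemma integral_pi_resample {ν ν' : ι → Measure Ω} [∀ i, IsProbabilityMeasure (ν i)]
    [∀ i, IsProbabilityMeasure (ν' i)] (i : ι) (h : ∀ j ≠ i, ν' j = ν j) {F : (ι → Ω) → ℝ}
    (hF : Measurable F) {B : ℝ} (hB : ∀ a, |F a| ≤ B) :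
    ∫ a, F a ∂Measure.pi ν' =
      ∫ a, ∫ s, F (Function.update a i s) ∂(ν' i) ∂Measure.pi ν := by
  rw [← map_update_prod_pi i h, integral_map (measurable_update_prod i).aemeasurable
    hF.aestronglyMeasurable]
  exact integral_prod _ (integrable_of_measurable_of_bounded
    (hF.comp (measurable_update_prod i)) fun _ => hB _)

lemma integrable_integral_update {ν : ι → Measure Ω} [∀ i, IsProbabilityMeasure (ν i)]
    {M : Measure Ω} [IsProbabilityMeasure M] (i : ι) {F : (ι → Ω) → ℝ}
    (hF : Measurable F) {B : ℝ} (hB : ∀ a, |F a| ≤ B) :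
    Integrable (fun a => ∫ s, F (Function.update a i s) ∂M) (Measure.pi ν) :=
  (integrable_of_measurable_of_bounded (μ := (Measure.pi ν).prod M)
    (hF.comp (measurable_update_prod i)) fun _ => hB _).integral_prod_left

/-- Comparison of the integrals over two product measures, one coordinate at a time. -/
lemma integral_pi_mono_of_update {ν ν' : ι → Measure Ω} [∀ i, IsProbabilityMeasure (ν i)]
    [∀ i, IsProbabilityMeasure (ν' i)] {F : (ι → Ω) → ℝ}
    (hF : Measurable F) {B : ℝ} (hB : ∀ a, |F a| ≤ B)
    (h : ∀ i a, ∫ s, F (Function.update a i s) ∂ν i ≤ ∫ s, F (Function.update a i s) ∂ν' i) :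
    ∫ a, F a ∂Measure.pi ν ≤ ∫ a, F a ∂Measure.pi ν' := by
  have hprob : ∀ T : Finset ι, ∀ i, IsProbabilityMeasure (T.piecewise ν' ν i) := by
    intro T i
    by_cases hi : i ∈ T <;> simp only [hi, Finset.piecewise_eq_of_mem,
      Finset.piecewise_eq_of_notMem, not_false_eq_true] <;> infer_instance
  -- Hybrid argument: the coordinates in `T` already have the law `ν'`, and `T` grows by one
  -- coordinate at a time.
  suffices H : ∀ T : Finset ι, ∫ a, F a ∂Measure.pi ν ≤ ∫ a, F a ∂Measure.pi (T.piecewise ν' ν) by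
    simpa using H Finset.univ
  intro T
  induction T using Finset.induction_on with
  | empty => simp
  | insert i T hi ih =>
    refine ih.trans ?_
    rw [integral_pi_resample (ν := T.piecewise ν' ν) (ν' := T.piecewise ν' ν) i
      (fun _ _ => rfl) hF hB,
      integral_pi_resample (ν := T.piecewise ν' ν) (ν' := (insert i T).piecewise ν' ν) i
      (fun j hj => Finset.piecewise_insert_of_ne (f := ν') (g := ν) (s := T) hj) hF hB]
    refine integral_mono (integrable_integral_update i hF hB)
      (integrable_integral_update i hF hB) fun a => ?_
    simp only [Finset.piecewise_eq_of_notMem _ _ _ hi, Finset.piecewise_insert_self]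
    exact h i a

end PiMeasure

/-! ### Comparison of a mixture with erasures -/

/-- The law of the crossover probability for an erasure channel of capacity `τ`. -/
def erasureLaw (τ : I) : Measure I :=
  ENNReal.ofReal τ • Measure.dirac 0 + ENNReal.ofReal (1 - τ) • Measure.dirac half

instance (τ : I) : IsProbabilityMeasure (erasureLaw τ) :=
  ⟨by
    have h0 : (0 : ℝ) ≤ 1 - τ := sub_nonneg.2 τ.2.2
    simp [erasureLaw, ← ENNReal.ofReal_add τ.2.1 h0]⟩

lemma integral_erasureLaw (τ : I) (f : I → ℝ) :
    ∫ s, f s ∂erasureLaw τ = τ * f 0 + (1 - τ) * f half := by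
  have hd : ∀ x : I, Integrable f (Measure.dirac x) := fun x => integrable_dirac (by simp)
  rw [erasureLaw, integral_add_measure ((hd 0).smul_measure ENNReal.ofReal_ne_top)
    ((hd half).smul_measure ENNReal.ofReal_ne_top), integral_smul_measure, integral_smul_measure,
    integral_dirac, integral_dirac, ENNReal.toReal_ofReal τ.2.1,
    ENNReal.toReal_ofReal (sub_nonneg.2 τ.2.2), smul_eq_mul, smul_eq_mul]

lemma ae_erasureLaw (τ : I) : ∀ᵐ s ∂erasureLaw τ, s = 0 ∨ s = half := by
  rw [erasureLaw, ae_add_measure_iff]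
  constructor <;> refine Measure.ae_smul_measure ?_ _ <;> simp [ae_dirac_eq]

lemma exists_bound_outInfo (p : (ι → ZMod 2) → ℝ) : ∃ B, ∀ a, |outInfo p a| ≤ B := by
  obtain ⟨B, hB⟩ := isCompact_univ.exists_bound_of_continuousOn (continuous_outInfo p).continuousOn
  exact ⟨B, fun a => hB a (Set.mem_univ a)⟩

lemma abs_meanSqBias_le_one {p : (ι → ZMod 2) → ℝ} (hp : ∀ x, 0 ≤ p x) (hp1 : ∑ x, p x = 1)
    (i : ι) (a : ι → I) : |meanSqBias p i a| ≤ 1 :=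
  abs_le.2 ⟨by linarith [meanSqBias_nonneg hp a i], meanSqBias_le_one hp hp1 a i⟩

lemma integrable_of_continuous {M : Measure I} [IsProbabilityMeasure M] {f : I → ℝ}
    (hf : Continuous f) : Integrable f M := by
  obtain ⟨B, hB⟩ := isCompact_univ.exists_bound_of_continuousOn hf.continuousOn
  exact integrable_of_measurable_of_bounded hf.measurable fun a => hB a (Set.mem_univ a)

lemma integrable_outInfo_update (p : (ι → ZMod 2) → ℝ) (M : Measure I) [IsProbabilityMeasure M]
    (a : ι → I) (i : ι) : Integrable (fun s => outInfo p (Function.update a i s)) M :=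
  integrable_of_continuous ((continuous_outInfo p).comp (continuous_const.update i continuous_id))

lemma integral_outInfo_update_sub (p : (ι → ZMod 2) → ℝ) (M : Measure I) [IsProbabilityMeasure M]
    (a : ι → I) (i : ι) :
    ∫ s, (outInfo p (Function.update a i s) - outInfo p (Function.update a i half)) ∂M =
      ∫ s, outInfo p (Function.update a i s) ∂M -
        ∫ s, outInfo p (Function.update a i s) ∂Measure.dirac half := by
  rw [integral_sub (integrable_outInfo_update p M a i) (integrable_const _), integral_dirac]
  simp

/-- Among the mixtures of binary symmetric channels of given capacity, the erasure channel
transmits the most information, for every input law. -/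
theorem integral_outInfo_le_erasureLaw {p : (ι → ZMod 2) → ℝ} (hp : ∀ x, 0 ≤ p x)
    (hp1 : ∑ x, p x = 1) {M : Measure I} [IsProbabilityMeasure M] {τ : I}
    (hM : ∫ s : I, biasInfo (1 - 2 * s) ∂M = τ * Real.log 2) :
    ∫ a, outInfo p a ∂Measure.pi (fun _ : ι => M) ≤
      ∫ a, outInfo p a ∂Measure.pi (fun _ : ι => erasureLaw τ) := by
  obtain ⟨B, hB⟩ := exists_bound_outInfo p
  have hG := (continuous_outInfo p).measurable
  have hl : 0 < Real.log 2 := Real.log_pos one_lt_two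
  have hi : Integrable (fun s : I => biasInfo (1 - 2 * s)) M :=
    integrable_of_continuous (by fun_prop)
  refine integral_pi_mono_of_update hG hB fun i a => ?_
  rw [integral_erasureLaw]
  -- On averaging `outInfo_update_le` over `M`, its coefficient becomes `τ` by `hM`, which is the
  -- average over `erasureLaw τ`.
  refine (integral_mono (integrable_outInfo_update p M a i) ?_ fun s => outInfo_update_le hp hp1 a i s).trans_eq ?_
  · exact (integrable_const _).add ((hi.div_const _).mul_const _)
  · rw [integral_add (integrable_const _) ((hi.div_const _).mul_const _), integral_mul_const,
      integral_div, hM, mul_div_cancel_right₀ _ hl.ne']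
    simp
    ring

/-- Under `ν` output `i` is useless, so passing to `ν'` adds exactly the gain from that output,
averaged over the others. -/
lemma integral_outInfo_sub {p : (ι → ZMod 2) → ℝ} {ν ν' : ι → Measure I}
    [∀ i, IsProbabilityMeasure (ν i)] [∀ i, IsProbabilityMeasure (ν' i)] {i : ι}
    (h : ∀ j ≠ i, ν' j = ν j) (hi : ν i = Measure.dirac half) :
    ∫ a, outInfo p a ∂Measure.pi ν' - ∫ a, outInfo p a ∂Measure.pi ν =
      ∫ a, ∫ s, (outInfo p (Function.update a i s) - outInfo p (Function.update a i half)) ∂ν' i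
        ∂Measure.pi ν := by
  obtain ⟨B, hB⟩ := exists_bound_outInfo p
  have hG := (continuous_outInfo p).measurable
  rw [integral_pi_resample i h hG hB, integral_pi_resample (ν := ν) (ν' := ν) i (fun _ _ => rfl)
    hG hB, ← integral_sub (integrable_integral_update i hG hB)
    (integrable_integral_update i hG hB)]
  refine integral_congr_ae (ae_of_all _ fun a => ?_)
  simp only
  rw [integral_outInfo_update_sub, hi]

lemma integral_one_sub_meanSqBias {p : (ι → ZMod 2) → ℝ} (hp : ∀ x, 0 ≤ p x)
    (hp1 : ∑ x, p x = 1) (i : ι) (ν : ι → Measure I) [∀ i, IsProbabilityMeasure (ν i)] (c : ℝ) :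
    Integrable (fun a => c * (1 - meanSqBias p i a)) (Measure.pi ν) ∧
    ∫ a, c * (1 - meanSqBias p i a) ∂Measure.pi ν =
      c * (1 - ∫ a, meanSqBias p i a ∂Measure.pi ν) := by
  have hQ : Integrable (meanSqBias p i) (Measure.pi ν) :=
    integrable_of_measurable_of_bounded (measurable_meanSqBias p i)
      (abs_meanSqBias_le_one hp hp1 i)
  refine ⟨((integrable_const 1).sub hQ).const_mul c, ?_⟩
  rw [integral_const_mul, integral_sub (integrable_const _) hQ]
  simp

lemma le_integral_outInfo_sub {p : (ι → ZMod 2) → ℝ} (hp : ∀ x, 0 ≤ p x)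
    (hp1 : ∑ x, p x = 1) {ν ν' : ι → Measure I}
    [∀ i, IsProbabilityMeasure (ν i)] [∀ i, IsProbabilityMeasure (ν' i)] {i : ι}
    (h : ∀ j ≠ i, ν' j = ν j) (hi : ν i = Measure.dirac half) :
    (∫ s : I, biasInfo (1 - 2 * s) ∂ν' i) * (1 - ∫ a, meanSqBias p i a ∂Measure.pi ν) ≤
      ∫ a, outInfo p a ∂Measure.pi ν' - ∫ a, outInfo p a ∂Measure.pi ν := by
  obtain ⟨B, hB⟩ := exists_bound_outInfo p
  have hG := (continuous_outInfo p).measurable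
  obtain ⟨h1, h2⟩ := integral_one_sub_meanSqBias hp hp1 i ν (∫ s : I, biasInfo (1 - 2 * s) ∂ν' i)
  rw [integral_outInfo_sub h hi, ← h2]
  refine integral_mono h1 ?_ fun a => ?_
  · simp only [integral_outInfo_update_sub]
    exact (integrable_integral_update i hG hB).sub (integrable_integral_update i hG hB)
  · simp only
    rw [← integral_mul_const]
    exact integral_mono ((integrable_of_continuous (by fun_prop)).mul_const _) ((integrable_outInfo_update p _ a i).sub
      (integrable_const _)) fun s => le_outInfo_update_sub hp hp1 a i s

lemma integral_outInfo_sub_of_coset {p : (ι → ZMod 2) → ℝ} (hp : ∀ x, 0 ≤ p x)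
    (hp1 : ∑ x, p x = 1) (hC : ∀ x x', p x ≠ 0 → p x' ≠ 0 → ∀ z, p (z + (x' - x)) = p z)
    {ν ν' : ι → Measure I}
    [∀ i, IsProbabilityMeasure (ν i)] [∀ i, IsProbabilityMeasure (ν' i)] {i : ι} {τ : I}
    (h : ∀ j ≠ i, ν' j = ν j) (hi : ν i = Measure.dirac half) (hi' : ν' i = erasureLaw τ)
    (hν : ∀ j, ∀ᵐ s ∂ν j, s = 0 ∨ s = half) :
    ∫ a, outInfo p a ∂Measure.pi ν' - ∫ a, outInfo p a ∂Measure.pi ν =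
      τ * Real.log 2 * (1 - ∫ a, meanSqBias p i a ∂Measure.pi ν) := by
  obtain ⟨h1, h2⟩ := integral_one_sub_meanSqBias hp hp1 i ν (τ * Real.log 2)
  have hae : ∀ᵐ a ∂Measure.pi ν, ∀ j, a j = 0 ∨ a j = half :=
    ae_all_iff.2 fun j => (measurePreserving_eval ν j).quasiMeasurePreserving.ae (hν j)
  rw [integral_outInfo_sub h hi, ← h2]
  refine integral_congr_ae ?_
  filter_upwards [hae] with a ha
  rw [hi', integral_erasureLaw, outInfo_update_zero_sub_of_coset hp hp1 hC ha]
  ring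

/-- The integrated chord bound involves `M` only through the mean of `(1 - 2s) ^ 2`. Its slope is
nonnegative, because a noiseless output yields a larger mean squared bias than an erased one, so
that mean may be replaced by `τ`. -/
lemma integral_meanSqBias_update_le {p : (ι → ZMod 2) → ℝ} (hp : ∀ x, 0 ≤ p x)
    (hp1 : ∑ x, p x = 1) {M : Measure I} [IsProbabilityMeasure M] {τ : I}
    (hM : ∫ s : I, (1 - 2 * (s : ℝ)) ^ 2 ∂M ≤ (τ : ℝ)) {i j : ι} (a : ι → I) :
    ∫ s, meanSqBias p i (Function.update a j s) ∂M ≤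
      ∫ s, meanSqBias p i (Function.update a j s) ∂erasureLaw τ := by
  rcases eq_or_ne i j with rfl | hij
  · simp [meanSqBias_update_self]
  have hi : Integrable (fun s : I => (1 - 2 * (s : ℝ)) ^ 2) M :=
    integrable_of_continuous (by fun_prop)
  have hmono := (meanSqBias_update_le hp hij a 0).2
  rw [integral_erasureLaw]
  calc ∫ s, meanSqBias p i (Function.update a j s) ∂M
      ≤ ∫ s : I, ((1 - 2 * (s : ℝ)) ^ 2 * (meanSqBias p i (Function.update a j 0) -
          meanSqBias p i (Function.update a j half)) +
            meanSqBias p i (Function.update a j half)) ∂M := by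
        refine integral_mono (integrable_of_measurable_of_bounded
          ((measurable_meanSqBias p i).comp (measurable_update a))
          fun _ => abs_meanSqBias_le_one hp hp1 i _)
          ((hi.mul_const _).add (integrable_const _)) fun s => ?_
        have := (meanSqBias_update_le hp hij a s).1
        simp only
        linarith
    _ = (∫ s : I, (1 - 2 * (s : ℝ)) ^ 2 ∂M) * (meanSqBias p i (Function.update a j 0) -
          meanSqBias p i (Function.update a j half)) +
            meanSqBias p i (Function.update a j half) := by
        rw [integral_add (hi.mul_const _) (integrable_const _), integral_mul_const]
        simp
    _ ≤ _ := by
        have := mul_le_mul_of_nonneg_right hM (sub_nonneg.2 hmono)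
        linarith

/-- For inputs uniform on a coset, the information through a mixture of binary symmetric channels
is at least a fixed multiple of the information through an erasure channel that is less noisy. -/
theorem mul_integral_outInfo_erasureLaw_le {p : (ι → ZMod 2) → ℝ} (hp : ∀ x, 0 ≤ p x)
    (hp1 : ∑ x, p x = 1) (hC : ∀ x x', p x ≠ 0 → p x' ≠ 0 → ∀ z, p (z + (x' - x)) = p z)
    {M : Measure I} [IsProbabilityMeasure M] {τ : I} {t : ℝ} (ht : 0 ≤ t)
    (hM : ∫ s : I, (1 - 2 * (s : ℝ)) ^ 2 ∂M ≤ (τ : ℝ))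
    (hMt : ∫ s : I, biasInfo (1 - 2 * s) ∂M = t * Real.log 2) :
    t * ∫ a, outInfo p a ∂Measure.pi (fun _ : ι => erasureLaw τ) ≤
      τ * ∫ a, outInfo p a ∂Measure.pi (fun _ : ι => M) := by
  -- Only the outputs in `T` are observed; the others have crossover `half`. The induction on `T` is
  -- the chain rule.
  let hyb (M : Measure I) (T : Finset ι) : ι → Measure I :=
    T.piecewise (fun _ => M) fun _ => Measure.dirac half
  have hprob : ∀ (M : Measure I) [IsProbabilityMeasure M] (T : Finset ι) (i : ι),
      IsProbabilityMeasure (hyb M T i) := by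
    intro M _ T i
    by_cases hi : i ∈ T <;> simp only [hyb, hi, Finset.piecewise_eq_of_mem,
      Finset.piecewise_eq_of_notMem, not_false_eq_true] <;> infer_instance
  suffices H : ∀ T : Finset ι, t * ∫ a, outInfo p a ∂Measure.pi (hyb (erasureLaw τ) T) ≤
      τ * ∫ a, outInfo p a ∂Measure.pi (hyb M T) by
    simpa [hyb] using H Finset.univ
  intro T
  induction T using Finset.induction_on with
  | empty =>
    have h0 : ∫ a, outInfo p a ∂Measure.pi (fun _ : ι => Measure.dirac half) = 0 := by
      have : ∀ᵐ a ∂Measure.pi (fun _ : ι => Measure.dirac half), outInfo p a = 0 := by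
        have hae : ∀ᵐ a ∂Measure.pi (fun _ : ι => Measure.dirac half), ∀ j, a j = half :=
          ae_all_iff.2 fun j => (measurePreserving_eval (fun _ : ι => Measure.dirac half)
            j).quasiMeasurePreserving.ae (p := fun s => s = half) (by simp [ae_dirac_eq])
        filter_upwards [hae] with a ha
        rw [show a = fun _ => half from funext ha, outInfo_half hp1]
      rw [integral_congr_ae this, integral_zero]
    simp [hyb, h0]
  | insert i T hi ih =>
    have hne : ∀ M : Measure I, ∀ j ≠ i, hyb M (insert i T) j = hyb M T j := fun M j hj => by
      simp [hyb, Finset.piecewise, hj]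
    have hself : ∀ M : Measure I, hyb M (insert i T) i = M := fun M =>
      Finset.piecewise_insert_self ..
    have hhalf : ∀ M : Measure I, hyb M T i = Measure.dirac half := fun M =>
      Finset.piecewise_eq_of_notMem _ _ _ hi
    have hQ : ∫ a, meanSqBias p i a ∂Measure.pi (hyb M T) ≤
        ∫ a, meanSqBias p i a ∂Measure.pi (hyb (erasureLaw τ) T) := by
      refine integral_pi_mono_of_update (measurable_meanSqBias p i)
        (abs_meanSqBias_le_one hp hp1 i) fun j a => ?_
      by_cases hj : j ∈ T
      · simp only [hyb, Finset.piecewise_eq_of_mem _ _ _ hj]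
        exact integral_meanSqBias_update_le hp hp1 hM a
      · simp only [hyb, Finset.piecewise_eq_of_notMem _ _ _ hj, le_refl]
    have h1 := le_integral_outInfo_sub hp hp1 (hne M) (hhalf M)
    have h2 := integral_outInfo_sub_of_coset hp hp1 hC (hne (erasureLaw τ))
      (hhalf (erasureLaw τ)) (hself (erasureLaw τ)) (fun j => by
        by_cases hj : j ∈ T
        · simp only [hyb, Finset.piecewise_eq_of_mem _ _ _ hj]
          exact ae_erasureLaw τ
        · simp only [hyb, Finset.piecewise_eq_of_notMem _ _ _ hj]
          simp [ae_dirac_eq])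
    rw [hself, hMt] at h1
    have hl : 0 < Real.log 2 := Real.log_pos one_lt_two
    have h3 := mul_le_mul_of_nonneg_left h1 τ.2.1
    have h4 := mul_le_mul_of_nonneg_left hQ
      (mul_nonneg (mul_nonneg ht τ.2.1) hl.le : 0 ≤ t * τ * Real.log 2)
    -- The gain from output `i` is at least `t log 2 (1 - Q)` under `M` and exactly `τ log 2 (1 -
    -- Q')` under erasures, with mean squared biases `Q ≤ Q'` by `hQ`.
    linear_combination ih + h3 + t * h2 + h4

/-- The mean squared bias of a mixture of binary symmetric channels of capacity `t` is at most
`eta t`. -/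
lemma integral_sq_bias_le_eta {M : Measure I} [IsProbabilityMeasure M] {t : ℝ}
    (ht : t ∈ Set.Icc (0 : ℝ) 1)
    (hMt : ∫ s : I, biasInfo (1 - 2 * s) ∂M = t * Real.log 2) :
    ∫ s : I, (1 - 2 * (s : ℝ)) ^ 2 ∂M ≤ eta t := by
  have hmem : ∀ s : I, (1 - 2 * (s : ℝ)) ^ 2 ∈ Set.Icc (0 : ℝ) 1 := fun s =>
    ⟨sq_nonneg _, by rw [← sq_abs]; exact pow_le_one₀ (abs_nonneg _) (abs_one_sub_two_mul_le_one s)⟩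
  have hi : Integrable (fun s : I => (1 - 2 * (s : ℝ)) ^ 2) M :=
    integrable_of_continuous (by fun_prop)
  have hc : Continuous fun s : ℝ => biasInfo (√s) := by fun_prop
  -- Jensen: `biasInfo` at the root of the mean squared bias is at most the mean of `biasInfo`,
  -- which is `t log 2 = biasInfo (√(eta t))`. Strict monotonicity then compares the arguments.
  have hJ := convexOn_biasInfo_sqrt.map_integral_le (μ := M) hc.continuousOn isClosed_Icc
    (ae_of_all _ hmem) hi (integrable_of_continuous (by fun_prop))
  simp only [Real.sqrt_sq_eq_abs, biasInfo_abs] at hJ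
  rw [hMt, ← biasInfo_sqrt_eta ht] at hJ
  have h0 : 0 ≤ ∫ s : I, (1 - 2 * (s : ℝ)) ^ 2 ∂M := integral_nonneg fun s => (hmem s).1
  have h1 : ∫ s : I, (1 - 2 * (s : ℝ)) ^ 2 ∂M ≤ 1 :=
    (integral_mono hi (integrable_const 1) fun s => (hmem s).2).trans (by simp)
  have he := eta_mem_Icc ht
  have := (biasInfo_strictMonoOn.le_iff_le ⟨Real.sqrt_nonneg _, Real.sqrt_le_one.2 h1⟩
    ⟨Real.sqrt_nonneg _, Real.sqrt_le_one.2 he.2⟩).1 hJ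
  exact (Real.sqrt_le_sqrt_iff he.1).1 this


/-! ### Data processing and equivalent channels -/

section DataProcessing

variable {α β γ : Type*} [MeasurableSpace α] [MeasurableSpace β] [MeasurableSpace γ]

lemma mutualInfo_comp_le (P : Measure α) [IsProbabilityMeasure P] (W : Kernel α β)
    [IsMarkovKernel W] (K : Kernel β γ) [IsMarkovKernel K] :
    mutualInfo P (K ∘ₖ W) ≤ mutualInfo P W := by
  unfold mutualInfo
  refine ENNReal.div_le_div_right ?_ _
  rw [← Measure.parallelComp_comp_compProd, ← Measure.comp_assoc, Measure.prod_comp_right]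
  exact InformationTheory.klDiv_comp_right_le _ _ _

/-- Each channel is a degradation of the other, so data processing applies in both directions. -/
lemma mutualInfo_eq_of_comp {P : Measure α} [IsProbabilityMeasure P] {W : Kernel α β}
    [IsMarkovKernel W] {V : Kernel α γ} [IsMarkovKernel V] {K : Kernel β γ} [IsMarkovKernel K]
    {R : Kernel γ β} [IsMarkovKernel R] (hK : K ∘ₖ W = V) (hR : R ∘ₖ V = W) :
    mutualInfo P W = mutualInfo P V := by
  apply le_antisymm
  · conv_lhs => rw [← hR]
    exact mutualInfo_comp_le P V R
  · rw [← hK]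
    exact mutualInfo_comp_le P W K

lemma capacity_eq_of_comp {W : Kernel α β}
    [IsMarkovKernel W] {V : Kernel α γ} [IsMarkovKernel V] {K : Kernel β γ} [IsMarkovKernel K]
    {R : Kernel γ β} [IsMarkovKernel R] (hK : K ∘ₖ W = V) (hR : R ∘ₖ V = W) :
    capacity W = capacity V :=
  iSup_congr fun P => mutualInfo_eq_of_comp (P := (P : Measure α)) hK hR

lemma mutualInfo_map_equiv (P : Measure α) [IsProbabilityMeasure P] (W : Kernel α β)
    [IsMarkovKernel W] (e : β ≃ᵐ γ) : mutualInfo P (W.map e) = mutualInfo P W := by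
  have := Kernel.IsMarkovKernel.map W e.measurable
  symm
  refine mutualInfo_eq_of_comp (K := Kernel.deterministic e e.measurable)
    (R := Kernel.deterministic e.symm e.symm.measurable)
    (Kernel.deterministic_comp_eq_map e.measurable W) ?_
  rw [Kernel.deterministic_comp_eq_map, ← Kernel.map_comp_right _ e.measurable e.symm.measurable]
  simp

end DataProcessing

/-! ### Products of densities and of kernels -/

section Pi

lemma lintegral_pi_prod {ι : Type*} [Fintype ι] {Ω : ι → Type*} [∀ i, MeasurableSpace (Ω i)]
    (μ : ∀ i, Measure (Ω i)) [∀ i, IsProbabilityMeasure (μ i)] {f : ∀ i, Ω i → ℝ≥0∞}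
    (hf : ∀ i, Measurable (f i)) :
    ∫⁻ a, ∏ i, f i (a i) ∂Measure.pi μ = ∏ i, ∫⁻ s, f i s ∂μ i := by
  refine (lintegral_prod_eq_prod_lintegral_of_indepFun Finset.univ (fun i (a : ∀ i, Ω i) => f i (a i))
    (iIndepFun_pi fun i => (hf i).aemeasurable)
    fun i => (hf i).comp (measurable_pi_apply i)).trans ?_
  exact Finset.prod_congr rfl fun i _ => (measurePreserving_eval μ i).lintegral_comp (hf i)

lemma pi_withDensity {ι : Type*} [Fintype ι] {Ω : ι → Type*} [∀ i, MeasurableSpace (Ω i)]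
    (μ : ∀ i, Measure (Ω i)) [∀ i, IsProbabilityMeasure (μ i)] {f : ∀ i, Ω i → ℝ≥0∞}
    (hf : ∀ i, Measurable (f i)) [∀ i, SigmaFinite ((μ i).withDensity (f i))] :
    Measure.pi (fun i => (μ i).withDensity (f i)) =
      (Measure.pi μ).withDensity fun a => ∏ i, f i (a i) := by
  refine Measure.pi_eq fun s hs => ?_
  rw [withDensity_apply _ (.univ_pi hs), ← lintegral_indicator (.univ_pi hs)]
  have : (Set.univ.pi s).indicator (fun a => ∏ i, f i (a i)) =
      fun a => ∏ i, (s i).indicator (f i) (a i) := by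
    funext a
    by_cases ha : a ∈ Set.univ.pi s
    · rw [Set.indicator_of_mem ha]
      exact Finset.prod_congr rfl fun i _ => (Set.indicator_of_mem (ha i trivial) _).symm
    · rw [Set.indicator_of_notMem ha]
      simp only [Set.mem_pi, Set.mem_univ, true_implies, not_forall] at ha
      obtain ⟨i, hi⟩ := ha
      exact (Finset.prod_eq_zero (Finset.mem_univ i) (Set.indicator_of_notMem hi _)).symm
  rw [this, lintegral_pi_prod μ fun i => (hf i).indicator (hs i)]
  exact Finset.prod_congr rfl fun i _ => by
    rw [lintegral_indicator (hs i), withDensity_apply _ (hs i)]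

variable {β γ : Type*} [MeasurableSpace β] [MeasurableSpace γ]

/-- The kernel that applies `K` independently to each coordinate. -/
def piKernel (n : ℕ) (K : Kernel β γ) [IsMarkovKernel K] : Kernel (Fin n → β) (Fin n → γ) where
  toFun y := Measure.pi fun i => K (y i)
  measurable' := by
    refine Measurable.measure_of_isPiSystem_of_isProbabilityMeasure generateFrom_pi.symm
      isPiSystem_pi ?_
    rintro _ ⟨s, hs, rfl⟩
    simp only [Measure.pi_pi]
    refine Finset.measurable_fun_prod _ fun i _ => ?_
    exact (K.measurable_coe (hs i trivial)).comp (measurable_pi_apply i)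

lemma piKernel_apply (n : ℕ) (K : Kernel β γ) [IsMarkovKernel K] (y : Fin n → β) :
    piKernel n K y = Measure.pi fun i => K (y i) := rfl

instance (n : ℕ) (K : Kernel β γ) [IsMarkovKernel K] : IsMarkovKernel (piKernel n K) :=
  ⟨fun y => by rw [piKernel_apply]; infer_instance⟩

lemma memoryless_apply (n : ℕ) (W : Kernel (ZMod 2) β) (x : Fin n → ZMod 2) :
    memoryless n W x = Measure.pi fun i => W (x i) := rfl

lemma memoryless_comp (n : ℕ) (W : Kernel (ZMod 2) β) [IsMarkovKernel W] (K : Kernel β γ)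
    [IsMarkovKernel K] : piKernel n K ∘ₖ memoryless n W = memoryless n (K ∘ₖ W) := by
  ext x : 1
  rw [memoryless_apply]
  symm
  refine Measure.pi_eq fun s hs => ?_
  rw [Kernel.comp_apply' _ _ _ (.univ_pi hs), memoryless_apply]
  simp only [piKernel_apply, Measure.pi_pi]
  rw [lintegral_pi_prod (fun i => W (x i)) fun i => K.measurable_coe (hs i)]
  exact Finset.prod_congr rfl fun i _ => (Kernel.comp_apply' _ _ _ (hs i)).symm

lemma mutualInfo_memoryless_eq_of_comp {n : ℕ} {P : Measure (Fin n → ZMod 2)}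
    [IsProbabilityMeasure P] {W : Kernel (ZMod 2) β}
    [IsMarkovKernel W] {V : Kernel (ZMod 2) γ} [IsMarkovKernel V] {K : Kernel β γ}
    [IsMarkovKernel K] {R : Kernel γ β} [IsMarkovKernel R] (hK : K ∘ₖ W = V) (hR : R ∘ₖ V = W) :
    mutualInfo P (memoryless n W) = mutualInfo P (memoryless n V) :=
  mutualInfo_eq_of_comp (K := piKernel n K) (R := piKernel n R)
    (by rw [memoryless_comp, hK]) (by rw [memoryless_comp, hR])

end Pi

/-! ### Mutual information of a channel with a density -/

section Density

variable {α κ Ω : Type*} [MeasurableSpace α] [Fintype α] [MeasurableSingletonClass α]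
  [MeasurableSpace κ] [Fintype κ] [MeasurableSpace Ω]

/-- The measure on `κ × Ω` with slices `m k`. -/
def sliceMeasure (m : κ → Measure Ω) : Measure (κ × Ω) := ∑ k, (m k).map (Prod.mk k)

lemma eq_sliceMeasure [MeasurableSingletonClass κ] {μ : Measure (κ × Ω)} {m : κ → Measure Ω}
    (h : ∀ k S, MeasurableSet S → μ ({k} ×ˢ S) = m k S) : μ = sliceMeasure m := by
  ext s hs
  have hk : ∀ k, MeasurableSet (Prod.mk k ⁻¹' s) := fun k => measurable_prodMk_left hs
  have hU : s = ⋃ k, ({k} : Set κ) ×ˢ (Prod.mk k ⁻¹' s) := by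
    ext ⟨k, ω⟩; simp
  conv_lhs => rw [hU]
  rw [measure_iUnion, tsum_fintype, sliceMeasure, Measure.finsetSum_apply]
  · exact Finset.sum_congr rfl fun k _ => by
      rw [h k _ (hk k), Measure.map_apply measurable_prodMk_left hs]
  · intro k k' hkk'
    rw [Function.onFun, Set.disjoint_left]
    rintro ⟨a, ω⟩ ⟨h1, -⟩ ⟨h2, -⟩
    exact hkk' (h1.symm.trans h2)
  · exact fun k => (measurableSet_singleton k).prod (hk k)

lemma lintegral_sliceMeasure (m : κ → Measure Ω) {F : κ × Ω → ℝ≥0∞} (hF : Measurable F) :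
    ∫⁻ z, F z ∂sliceMeasure m = ∑ k, ∫⁻ ω, F (k, ω) ∂m k := by
  rw [sliceMeasure, lintegral_finsetSum_measure]
  exact Finset.sum_congr rfl fun k _ => lintegral_map hF measurable_prodMk_left

variable {V : Kernel α (κ × Ω)} [IsMarkovKernel V] {M : Measure Ω}
  {v : α → κ → Ω → ℝ} {P : Measure α} [IsProbabilityMeasure P]

/-- Together with `lintegral_prod_slice` this writes the joint law and the product of its marginals
over one reference, counting measure times `M`, so that their densities can be divided. -/
lemma lintegral_compProd_slice (hv : ∀ x k, Measurable (v x k))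
    (hV : ∀ x, V x = sliceMeasure fun k => M.withDensity fun ω => ENNReal.ofReal (v x k ω))
    {F : α × (κ × Ω) → ℝ≥0∞} (hF : Measurable F) :
    ∫⁻ z, F z ∂(P ⊗ₘ V) =
      ∑ x, ∑ k, ∫⁻ ω, F (x, k, ω) * ENNReal.ofReal (P.real {x} * v x k ω) ∂M := by
  rw [Measure.lintegral_compProd hF, lintegral_fintype]
  refine Finset.sum_congr rfl fun x _ => ?_
  rw [hV, lintegral_sliceMeasure (F := fun z => F (x, z)) _ (hF.comp measurable_prodMk_left),
    Finset.sum_mul]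
  refine Finset.sum_congr rfl fun k _ => ?_
  have hFk : Measurable fun ω => F (x, k, ω) :=
    hF.comp (measurable_prodMk_left.comp measurable_prodMk_left)
  rw [lintegral_withDensity_eq_lintegral_mul _ (hv x k).ennreal_ofReal hFk,
    ← lintegral_mul_const _ ((hv x k).ennreal_ofReal.mul hFk)]
  refine lintegral_congr fun ω => ?_
  rw [ENNReal.ofReal_mul measureReal_nonneg, ofReal_measureReal, Pi.mul_apply]
  ring

lemma lintegral_prod_slice (hv : ∀ x k, Measurable (v x k)) (hv0 : ∀ x k ω, 0 ≤ v x k ω)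
    (hV : ∀ x, V x = sliceMeasure fun k => M.withDensity fun ω => ENNReal.ofReal (v x k ω))
    {F : α × (κ × Ω) → ℝ≥0∞} (hF : Measurable F) :
    ∫⁻ z, F z ∂(P.prod (V ∘ₘ P)) = ∑ x, ∑ k, ∫⁻ ω, F (x, k, ω) *
      ENNReal.ofReal (P.real {x} * ∑ x', P.real {x'} * v x' k ω) ∂M := by
  rw [lintegral_prod _ hF.aemeasurable, lintegral_fintype]
  refine Finset.sum_congr rfl fun x _ => ?_
  have hFx : Measurable fun z => F (x, z) := hF.comp measurable_prodMk_left
  rw [Measure.lintegral_bind V.aemeasurable hFx.aemeasurable, lintegral_fintype]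
  have e : ∀ x', ∫⁻ z, F (x, z) ∂V x' =
      ∑ k, ∫⁻ ω, F (x, k, ω) * ENNReal.ofReal (v x' k ω) ∂M := by
    intro x'
    rw [hV, lintegral_sliceMeasure _ hFx]
    refine Finset.sum_congr rfl fun k _ => ?_
    rw [lintegral_withDensity_eq_lintegral_mul _ (g := fun ω => F (x, k, ω))
      (hv x' k).ennreal_ofReal (hFx.comp measurable_prodMk_left)]
    exact lintegral_congr fun ω => mul_comm _ _
  simp only [e, Finset.sum_mul]
  rw [Finset.sum_comm]
  refine Finset.sum_congr rfl fun k _ => ?_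
  have hFk : Measurable fun ω => F (x, k, ω) := hFx.comp measurable_prodMk_left
  have hm : ∀ x', Measurable fun ω => F (x, k, ω) * ENNReal.ofReal (v x' k ω) := fun x' =>
    hFk.mul (hv x' k).ennreal_ofReal
  have hR : ∀ ω, F (x, k, ω) * ENNReal.ofReal (P.real {x} * ∑ x', P.real {x'} * v x' k ω) =
      ∑ x', F (x, k, ω) * ENNReal.ofReal (v x' k ω) * P {x'} * P {x} := by
    intro ω
    rw [ENNReal.ofReal_mul measureReal_nonneg, ofReal_measureReal,
      ENNReal.ofReal_sum_of_nonneg fun x' _ => mul_nonneg measureReal_nonneg (hv0 x' k ω),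
      Finset.mul_sum, Finset.mul_sum]
    refine Finset.sum_congr rfl fun x' _ => ?_
    rw [ENNReal.ofReal_mul measureReal_nonneg, ofReal_measureReal]
    ring
  simp only [hR]
  rw [lintegral_finsetSum _ fun x' _ => ((hm x').mul_const _).mul_const _]
  refine Finset.sum_congr rfl fun x' _ => ?_
  rw [lintegral_mul_const _ ((hm x').mul_const _), lintegral_mul_const _ (hm x')]

/-- Summed over inputs and outputs, the first two terms cancel and the last two give output entropy
minus conditional entropy. `hq` makes the default value of `v / 0` harmless. -/
lemma mul_klFun_div {p v q : ℝ} (hq : q = 0 → p * v = 0) :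
    InformationTheory.klFun (v / q) * (p * q) =
      p * q - p * v - p * Real.negMulLog v - p * v * Real.log q := by
  rw [InformationTheory.klFun_apply, Real.negMulLog]
  rcases eq_or_ne q 0 with rfl | h0
  · have := hq rfl
    simp only [div_zero, mul_zero, Real.log_zero]
    linear_combination (1 - Real.log v) * this
  rcases eq_or_ne v 0 with rfl | hv
  · simp
  rw [Real.log_div hv h0]
  field_simp
  ring

lemma sum_real_singleton : ∑ x, P.real {x} = 1 := by
  simp

/-- The mutual information of a channel with finite input, finite output and side information
independent of the input. -/
lemma mutualInfo_eq_of_slice [MeasurableSingletonClass κ] (hv : ∀ x k, Measurable (v x k)) (hv0 : ∀ x k ω, 0 ≤ v x k ω)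
    (hv1 : ∀ x ω, ∑ k, v x k ω = 1)
    (hV : ∀ x, V x = sliceMeasure fun k => M.withDensity fun ω => ENNReal.ofReal (v x k ω))
    (hint : Integrable (fun ω => ∑ k, Real.negMulLog (∑ x, P.real {x} * v x k ω) -
      ∑ x, P.real {x} * ∑ k, Real.negMulLog (v x k ω)) M) :
    mutualInfo P V = ENNReal.ofReal (∫ ω, (∑ k, Real.negMulLog (∑ x, P.real {x} * v x k ω) -
      ∑ x, P.real {x} * ∑ k, Real.negMulLog (v x k ω)) ∂M) / ENNReal.ofReal (Real.log 2) := by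
  unfold mutualInfo
  congr 1
  set q : κ → Ω → ℝ := fun k ω => ∑ x, P.real {x} * v x k ω with hq
  have hqm : ∀ k, Measurable (q k) := fun k =>
    Finset.measurable_fun_sum _ fun x _ => (hv x k).const_mul _
  have hq0 : ∀ k ω, 0 ≤ q k ω := fun k ω =>
    Finset.sum_nonneg fun x _ => mul_nonneg measureReal_nonneg (hv0 x k ω)
  have hle : ∀ x k ω, P.real {x} * v x k ω ≤ q k ω := fun x k ω =>
    Finset.single_le_sum (f := fun x => P.real {x} * v x k ω)
      (fun x _ => mul_nonneg measureReal_nonneg (hv0 x k ω)) (Finset.mem_univ x)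
  have hz : ∀ x k ω, q k ω = 0 → P.real {x} * v x k ω = 0 := fun x k ω h =>
    le_antisymm (h ▸ hle x k ω) (mul_nonneg measureReal_nonneg (hv0 x k ω))
  -- The likelihood ratio of the joint law to the product law; the factor `P.real {x}` has
  -- cancelled.
  let r : α × (κ × Ω) → ℝ := fun z => v z.1 z.2.1 z.2.2 / q z.2.1 z.2.2
  have hr : Measurable r := by
    refine measurable_from_prod_countable_right fun x => ?_
    refine measurable_from_prod_countable_right fun k => ?_
    exact (hv x k).div (hqm k)
  have hr0 : ∀ z, 0 ≤ r z := fun z => div_nonneg (hv0 _ _ _) (hq0 _ _)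
  have hden : P ⊗ₘ V = (P.prod (V ∘ₘ P)).withDensity fun z => ENNReal.ofReal (r z) := by
    ext s hs
    rw [withDensity_apply _ hs, ← lintegral_indicator hs, ← lintegral_indicator_one hs,
      lintegral_compProd_slice hv hV (measurable_one.indicator hs),
      lintegral_prod_slice hv hv0 hV (hr.ennreal_ofReal.indicator hs)]
    refine Finset.sum_congr rfl fun x _ => Finset.sum_congr rfl fun k _ =>
      lintegral_congr fun ω => ?_
    by_cases hmem : (x, k, ω) ∈ s
    · rw [Set.indicator_of_mem hmem, Set.indicator_of_mem hmem, Pi.one_apply, one_mul,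
        ← ENNReal.ofReal_mul (hr0 _)]
      congr 1
      change _ = v x k ω / q k ω * (P.real {x} * q k ω)
      rcases eq_or_ne (q k ω) 0 with h0 | h0
      · rw [hz x k ω h0, h0]; simp
      · field_simp
    · rw [Set.indicator_of_notMem hmem, Set.indicator_of_notMem hmem, zero_mul, zero_mul]
  have hac : P ⊗ₘ V ≪ P.prod (V ∘ₘ P) := by
    rw [hden]; exact withDensity_absolutelyContinuous _ _
  rw [InformationTheory.klDiv_eq_lintegral_klFun_of_ac hac]
  have hrn : (P ⊗ₘ V).rnDeriv (P.prod (V ∘ₘ P)) =ᵐ[P.prod (V ∘ₘ P)]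
      fun z => ENNReal.ofReal (r z) := by
    conv_lhs => rw [hden]
    exact Measure.rnDeriv_withDensity _ hr.ennreal_ofReal
  have hkl : ∫⁻ z, ENNReal.ofReal (InformationTheory.klFun
      ((P ⊗ₘ V).rnDeriv (P.prod (V ∘ₘ P)) z).toReal) ∂(P.prod (V ∘ₘ P)) =
      ∫⁻ z, ENNReal.ofReal (InformationTheory.klFun (r z)) ∂(P.prod (V ∘ₘ P)) := by
    refine lintegral_congr_ae ?_
    filter_upwards [hrn] with z hz
    rw [hz, ENNReal.toReal_ofReal (hr0 z)]
  rw [hkl, lintegral_prod_slice (F := fun z => ENNReal.ofReal (InformationTheory.klFun (r z)))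
    hv hv0 hV
    (InformationTheory.measurable_klFun.comp hr).ennreal_ofReal]
  let G : α → κ → Ω → ℝ := fun x k ω =>
    InformationTheory.klFun (r (x, k, ω)) * (P.real {x} * q k ω)
  have hG0 : ∀ x k ω, 0 ≤ G x k ω := fun x k ω =>
    mul_nonneg (InformationTheory.klFun_nonneg (hr0 _)) (mul_nonneg measureReal_nonneg (hq0 k ω))
  have hGm : ∀ x k, Measurable (G x k) := fun x k =>
    (InformationTheory.measurable_klFun.comp (hr.comp
      (measurable_prodMk_left.comp measurable_prodMk_left))).mul ((hqm k).const_mul _)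
  have hGsum : ∀ ω, ∑ x, ∑ k, G x k ω = ∑ k, Real.negMulLog (q k ω) -
      ∑ x, P.real {x} * ∑ k, Real.negMulLog (v x k ω) := by
    intro ω
    have e : ∀ x k, G x k ω = P.real {x} * q k ω - P.real {x} * v x k ω -
        P.real {x} * Real.negMulLog (v x k ω) - P.real {x} * v x k ω * Real.log (q k ω) :=
      fun x k => mul_klFun_div (hz x k ω)
    have e1 : ∑ k, q k ω = 1 := by
      simp only [hq]
      rw [Finset.sum_comm]
      simp only [← Finset.mul_sum, hv1, mul_one, sum_real_singleton]
    have e2 : ∑ x, ∑ k, P.real {x} * v x k ω * Real.log (q k ω) =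
        -∑ k, Real.negMulLog (q k ω) := by
      rw [Finset.sum_comm, ← Finset.sum_neg_distrib]
      refine Finset.sum_congr rfl fun k _ => ?_
      rw [← Finset.sum_mul, Real.negMulLog]
      ring
    simp only [e, Finset.sum_sub_distrib, e2]
    simp only [← Finset.mul_sum, e1, hv1, mul_one, sum_real_singleton]
    ring
  have hstep : ∀ x k, ∫⁻ ω, ENNReal.ofReal (InformationTheory.klFun (r (x, k, ω))) *
      ENNReal.ofReal (P.real {x} * ∑ x', P.real {x'} * v x' k ω) ∂M =
      ∫⁻ ω, ENNReal.ofReal (G x k ω) ∂M := fun x k => lintegral_congr fun ω =>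
    (ENNReal.ofReal_mul (InformationTheory.klFun_nonneg (hr0 _))).symm
  have hfun : (fun ω => ∑ k, Real.negMulLog (q k ω) - ∑ x, P.real {x} *
      ∑ k, Real.negMulLog (v x k ω)) = fun ω => ∑ x, ∑ k, G x k ω :=
    funext fun ω => (hGsum ω).symm
  rw [Finset.sum_congr rfl fun x _ => Finset.sum_congr rfl fun k _ => hstep x k]
  rw [hfun] at hint ⊢
  rw [ofReal_integral_eq_lintegral_ofReal hint (ae_of_all _ fun ω =>
    Finset.sum_nonneg fun x _ => Finset.sum_nonneg fun k _ => hG0 x k ω)]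
  have hsum : ∀ x, ∑ k, ∫⁻ ω, ENNReal.ofReal (G x k ω) ∂M = ∫⁻ ω, ∑ k, ENNReal.ofReal (G x k ω) ∂M :=
    fun x => (lintegral_finsetSum _ fun k _ => (hGm x k).ennreal_ofReal).symm
  rw [Finset.sum_congr rfl fun x _ => hsum x, ← lintegral_finsetSum _ fun x _ => Finset.measurable_fun_sum _
    fun k _ => (hGm x k).ennreal_ofReal]
  refine lintegral_congr fun ω => ?_
  rw [ENNReal.ofReal_sum_of_nonneg fun x _ => Finset.sum_nonneg fun k _ => hG0 x k ω]
  exact Finset.sum_congr rfl fun x _ =>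
    (ENNReal.ofReal_sum_of_nonneg fun k _ => hG0 x k ω).symm

end Density


/-! ### Mixtures of binary symmetric channels -/

/-- The mixture of binary symmetric channels whose crossover probability is drawn from `M` and
revealed to the receiver. -/
def bscMix (M : Measure I) : Kernel (ZMod 2) (ZMod 2 × I) :=
  Kernel.ofFunOfCountable fun x =>
    sliceMeasure fun k => M.withDensity fun a => ENNReal.ofReal (flipProb (k - x) a)

lemma bscMix_apply (M : Measure I) (x : ZMod 2) : bscMix M x =
    sliceMeasure fun k => M.withDensity fun a => ENNReal.ofReal (flipProb (k - x) a) := rfl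

lemma measurable_flipProb (z : ZMod 2) : Measurable (flipProb z) :=
  (continuous_flipProb z).measurable

lemma sum_flipProb_sub (x : ZMod 2) (a : I) : ∑ k, flipProb (k - x) a = 1 := by
  rw [← sum_flipProb a]
  exact Equiv.sum_comp (Equiv.subRight x) fun z => flipProb z a

instance (M : Measure I) [IsProbabilityMeasure M] : IsMarkovKernel (bscMix M) :=
  ⟨fun x => ⟨by
    rw [← lintegral_one, bscMix_apply, lintegral_sliceMeasure _ measurable_const]
    simp only [lintegral_one, withDensity_apply _ MeasurableSet.univ, Measure.restrict_univ]
    rw [← lintegral_finsetSum _ fun k _ => (measurable_flipProb (k - x)).ennreal_ofReal]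
    simp [← ENNReal.ofReal_sum_of_nonneg fun k _ => flipProb_nonneg (k - x) _,
      sum_flipProb_sub]⟩⟩

lemma sliceMeasure_apply {κ Ω : Type*} [MeasurableSpace κ] [Fintype κ]
    [MeasurableSingletonClass κ] [MeasurableSpace Ω] (m : κ → Measure Ω) (k : κ) {S : Set Ω}
    (hS : MeasurableSet S) : sliceMeasure m ({k} ×ˢ S) = m k S := by
  classical
  have hm := (measurableSet_singleton k).prod hS
  rw [sliceMeasure, Measure.finsetSum_apply, Finset.sum_eq_single k]
  · rw [Measure.map_apply measurable_prodMk_left hm]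
    congr 1
    ext; simp
  · intro k' _ hk'
    rw [Measure.map_apply measurable_prodMk_left hm]
    convert measure_empty (μ := m k')
    ext; simp [hk']
  · simp

/-- The product of mixtures of binary symmetric channels, with the crossover probabilities
collected. -/
lemma memoryless_bscMix_map (n : ℕ) (M : Measure I) [IsProbabilityMeasure M]
    (x : Fin n → ZMod 2) :
    (memoryless n (bscMix M)).map (MeasurableEquiv.arrowProdEquivProdArrow (ZMod 2) I (Fin n)) x =
      sliceMeasure fun k => (Measure.pi fun _ => M).withDensity fun a =>
        ENNReal.ofReal (∏ i, flipProb (k i - x i) (a i)) := by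
  set e := MeasurableEquiv.arrowProdEquivProdArrow (ZMod 2) I (Fin n)
  refine eq_sliceMeasure fun k S hS => ?_
  rw [Kernel.map_apply _ e.measurable, memoryless_apply]
  have hk : MeasurableSet (({k} : Set (Fin n → ZMod 2)) ×ˢ (Set.univ : Set (Fin n → I))) :=
    (measurableSet_singleton k).prod .univ
  -- Fixing the output bits `k` and projecting to the crossovers leaves a measure that can be
  -- identified as a product on boxes.
  have hpi : (((Measure.pi fun i => bscMix M (x i)).map e).restrict ({k} ×ˢ Set.univ)).map
      Prod.snd = (Measure.pi fun _ => M).withDensity fun a =>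
        ENNReal.ofReal (∏ i, flipProb (k i - x i) (a i)) := by
    simp only [ENNReal.ofReal_prod_of_nonneg fun i _ => flipProb_nonneg _ _]
    rw [← pi_withDensity (fun _ : Fin n => M) fun i =>
      (measurable_flipProb (k i - x i)).ennreal_ofReal]
    refine (Measure.pi_eq fun s hs => ?_).symm
    rw [Measure.map_apply measurable_snd (.univ_pi hs),
      Measure.restrict_apply (measurable_snd (.univ_pi hs)),
      Measure.map_apply e.measurable ((measurable_snd (.univ_pi hs)).inter hk)]
    have : e ⁻¹' (Prod.snd ⁻¹' Set.univ.pi s ∩ {k} ×ˢ Set.univ) =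
        Set.univ.pi fun i => ({k i} : Set (ZMod 2)) ×ˢ s i := by
      ext z
      simp only [e, MeasurableEquiv.arrowProdEquivProdArrow, Equiv.arrowProdEquivProdArrow,
        MeasurableEquiv.coe_mk, Equiv.coe_fn_mk, Set.mem_preimage, Set.mem_inter_iff, Set.mem_pi,
        Set.mem_univ, true_implies, Set.mem_prod, Set.mem_singleton_iff, and_true, funext_iff]
      exact ⟨fun h i => ⟨h.2 i, h.1 i⟩, fun h => ⟨fun i => (h i).2, fun i => (h i).1⟩⟩
    rw [this, Measure.pi_pi]
    exact Finset.prod_congr rfl fun i _ => by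
      rw [bscMix_apply, sliceMeasure_apply _ _ (hs i)]
  rw [← hpi, Measure.map_apply measurable_snd hS, Measure.restrict_apply (measurable_snd hS)]
  congr 1
  ext ⟨k', a⟩
  simp [and_comm]

lemma sum_negMulLog_flipProb (x : ZMod 2) (a : I) :
    ∑ k, Real.negMulLog (flipProb (k - x) a) = Real.binEntropy a := by
  rw [show ∑ k, Real.negMulLog (flipProb (k - x) a) = ∑ z, Real.negMulLog (flipProb z a) from
    Equiv.sum_comp (Equiv.subRight x) fun z => Real.negMulLog (flipProb z a),
    show (Finset.univ : Finset (ZMod 2)) = {0, 1} by decide, Finset.sum_pair zero_ne_one,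
    Real.binEntropy_eq_negMulLog_add_negMulLog_one_sub]
  simp [flipProb, add_comm]

/-- Additivity of the entropy over products. -/
lemma sum_negMulLog_prod {ι κ : Type*} [Fintype ι] [DecidableEq ι] [Fintype κ]
    {f : ι → κ → ℝ} (hf : ∀ i, ∑ z, f i z = 1) :
    ∑ k : ι → κ, Real.negMulLog (∏ i, f i (k i)) = ∑ i, ∑ z, Real.negMulLog (f i z) := by
  -- The logarithm of the product splits into a sum. Its `i`-th summand is again a product, with
  -- only factor `i` changed, so the sum over `k` factorizes.
  have h1 : ∀ k : ι → κ, Real.negMulLog (∏ i, f i (k i)) =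
      ∑ i, ∏ j, Function.update f i (fun z => Real.negMulLog (f i z)) j (k j) := by
    intro k
    have h2 : ∀ i, ∏ j, Function.update f i (fun z => Real.negMulLog (f i z)) j (k j) =
        -((∏ j, f j (k j)) * Real.log (f i (k i))) := by
      intro i
      rw [← Finset.mul_prod_erase _ _ (Finset.mem_univ i),
        ← Finset.mul_prod_erase _ (fun j => f j (k j)) (Finset.mem_univ i), Function.update_self,
        Finset.prod_congr rfl fun j hj => by
          rw [Function.update_of_ne (Finset.ne_of_mem_erase hj)], Real.negMulLog]
      ring
    simp only [h2, Finset.sum_neg_distrib, ← Finset.mul_sum]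
    by_cases h0 : ∏ j, f j (k j) = 0
    · simp [h0]
    · rw [Real.negMulLog, Real.log_prod fun i hi => Finset.prod_ne_zero_iff.1 h0 i hi]
      ring
  simp only [h1]
  rw [Finset.sum_comm]
  refine Finset.sum_congr rfl fun i _ => ?_
  rw [← Fintype.prod_sum fun j z => Function.update f i (fun z => Real.negMulLog (f i z)) j z,
    ← Finset.mul_prod_erase _ _ (Finset.mem_univ i), Function.update_self,
    Finset.prod_eq_one, mul_one]
  intro j hj
  rw [Function.update_of_ne (Finset.ne_of_mem_erase hj), hf]

lemma mutualInfo_memoryless_bscMix {n : ℕ} (P : Measure (Fin n → ZMod 2))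
    [IsProbabilityMeasure P] (M : Measure I) [IsProbabilityMeasure M] :
    mutualInfo P (memoryless n (bscMix M)) =
      ENNReal.ofReal (∫ a, outInfo (fun x => P.real {x}) a ∂Measure.pi fun _ => M) /
        ENNReal.ofReal (Real.log 2) := by
  have hV := memoryless_bscMix_map n M
  generalize MeasurableEquiv.arrowProdEquivProdArrow (ZMod 2) I (Fin n) = e at hV
  have := Kernel.IsMarkovKernel.map (memoryless n (bscMix M)) e.measurable
  have hfun : ∀ a : Fin n → I, (∑ k : Fin n → ZMod 2,
      Real.negMulLog (∑ x, P.real {x} * ∏ i, flipProb (k i - x i) (a i)) -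
      ∑ x, P.real {x} * ∑ k : Fin n → ZMod 2,
        Real.negMulLog (∏ i, flipProb (k i - x i) (a i))) =
      outInfo (fun x => P.real {x}) a := by
    intro a
    have h1 : ∀ x : Fin n → ZMod 2, ∑ k : Fin n → ZMod 2,
        Real.negMulLog (∏ i, flipProb (k i - x i) (a i)) = ∑ i, Real.binEntropy (a i) := by
      intro x
      rw [sum_negMulLog_prod (f := fun i z => flipProb (z - x i) (a i))
        fun i => sum_flipProb_sub _ _]
      exact Finset.sum_congr rfl fun i _ => sum_negMulLog_flipProb _ _
    simp only [h1, ← Finset.sum_mul, sum_real_singleton, one_mul]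
    rfl
  have hint : Integrable (outInfo fun x => P.real {x}) (Measure.pi fun _ : Fin n => M) := by
    obtain ⟨B, hB⟩ := exists_bound_outInfo fun x => P.real {x}
    exact integrable_of_measurable_of_bounded (continuous_outInfo _).measurable hB
  have hm : ∀ x k : Fin n → ZMod 2, Measurable fun a : Fin n → I =>
      ∏ i, flipProb (k i - x i) (a i) := fun x k =>
    (continuous_finsetProd _ fun i _ =>
      (continuous_flipProb _).comp (continuous_apply i)).measurable
  rw [← mutualInfo_map_equiv P _ e, mutualInfo_eq_of_slice hm
    (fun x k a => Finset.prod_nonneg fun i _ => flipProb_nonneg _ _)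
    (fun x a => sum_prod_flipProb a x) hV]
  · simp only [hfun]
  · simp only [hfun]
    exact hint

lemma sum_negMulLog_eq_binEntropy {q : ZMod 2 → ℝ} (hq : ∑ k, q k = 1) :
    ∑ k, Real.negMulLog (q k) = Real.binEntropy (q 0) := by
  rw [show (Finset.univ : Finset (ZMod 2)) = {0, 1} by decide, Finset.sum_pair zero_ne_one]
    at hq ⊢
  rw [Real.binEntropy_eq_negMulLog_add_negMulLog_one_sub, ← hq]
  simp

lemma mutualInfo_bscMix (P : Measure (ZMod 2)) [IsProbabilityMeasure P] (M : Measure I)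
    [IsProbabilityMeasure M] :
    mutualInfo P (bscMix M) = ENNReal.ofReal (∫ a : I, (Real.binEntropy
      (∑ x, P.real {x} * flipProb (0 - x) a) - Real.binEntropy a) ∂M) /
        ENNReal.ofReal (Real.log 2) := by
  have hfun : ∀ a : I, (∑ k, Real.negMulLog (∑ x, P.real {x} * flipProb (k - x) a) -
      ∑ x, P.real {x} * ∑ k, Real.negMulLog (flipProb (k - x) a)) =
      Real.binEntropy (∑ x, P.real {x} * flipProb (0 - x) a) - Real.binEntropy a := by
    intro a
    simp only [sum_negMulLog_flipProb, ← Finset.sum_mul, sum_real_singleton, one_mul]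
    rw [sum_negMulLog_eq_binEntropy]
    rw [Finset.sum_comm]
    simp only [← Finset.mul_sum, sum_flipProb_sub, mul_one, sum_real_singleton]
  have hc : Continuous fun a : I => Real.binEntropy
      (∑ x, P.real {x} * flipProb (0 - x) a) - Real.binEntropy a := by fun_prop
  rw [mutualInfo_eq_of_slice (v := fun x k a => flipProb (k - x) a)
    (fun x k => measurable_flipProb _) (fun x k a => flipProb_nonneg _ _)
    (fun x a => sum_flipProb_sub x a) (bscMix_apply M)]
  · simp only [hfun]
  · simp only [hfun]
    exact integrable_of_continuous hc

/-- The output entropy for a given crossover is at most `log 2`, and a uniform input attains this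
for all crossovers at once. -/
lemma capacity_bscMix (M : Measure I) [IsProbabilityMeasure M] :
    capacity (bscMix M) = ENNReal.ofReal (∫ a : I, biasInfo (1 - 2 * a) ∂M) /
      ENNReal.ofReal (Real.log 2) := by
  have hb : ∀ a : I, biasInfo (1 - 2 * a) = Real.log 2 - Real.binEntropy a := fun a => by
    rw [biasInfo]; ring_nf
  apply le_antisymm
  · refine iSup_le fun P => ?_
    rw [mutualInfo_bscMix]
    refine ENNReal.div_le_div_right (ENNReal.ofReal_le_ofReal ?_) _
    refine integral_mono (integrable_of_continuous (by fun_prop))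
      (integrable_of_continuous (by fun_prop)) fun a => ?_
    simp only [hb]
    linarith [Real.binEntropy_le_log_two (p := ∑ x, (P : Measure (ZMod 2)).real {x} *
      flipProb (0 - x) a)]
  · have hP : IsProbabilityMeasure (uniformOn (Set.univ : Set (ZMod 2))) :=
      isProbabilityMeasure_uniformOn Set.finite_univ Set.univ_nonempty
    refine le_iSup_of_le ⟨uniformOn Set.univ, hP⟩ ?_
    rw [ProbabilityMeasure.coe_mk, mutualInfo_bscMix]
    apply le_of_eq
    congr 3
    funext a
    have hr : ∀ x : ZMod 2, (uniformOn (Set.univ : Set (ZMod 2))).real {x} = 2⁻¹ := fun x => by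
      simp [measureReal_def, uniformOn_univ, ZMod.card]
    have hs : ∑ x : ZMod 2, flipProb (0 - x) a = 1 := by
      rw [← sum_flipProb a]
      exact Equiv.sum_comp (Equiv.subLeft 0) fun z => flipProb z a
    rw [hb]
    simp only [hr]
    rw [← Finset.mul_sum, hs, mul_one, Real.binEntropy_two_inv]

lemma integral_biasInfo_of_capacity {M : Measure I} [IsProbabilityMeasure M] {t : ℝ} (ht : 0 ≤ t)
    (h : capacity (bscMix M) = ENNReal.ofReal t) :
    ∫ a : I, biasInfo (1 - 2 * a) ∂M = t * Real.log 2 := by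
  have hl : 0 < Real.log 2 := Real.log_pos one_lt_two
  have h0 : 0 ≤ ∫ a : I, biasInfo (1 - 2 * a) ∂M := integral_nonneg fun a => biasInfo_nonneg _
  rw [capacity_bscMix, ← ENNReal.ofReal_div_of_pos hl,
    ENNReal.ofReal_eq_ofReal_iff (by positivity) ht, div_eq_iff hl.ne'] at h
  exact h

lemma integral_biasInfo_erasureLaw (τ : I) :
    ∫ a : I, biasInfo (1 - 2 * a) ∂erasureLaw τ = τ * Real.log 2 := by
  rw [integral_erasureLaw]
  simp [coe_half, biasInfo_zero, biasInfo_one]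

/-! ### Reduction of BMS and erasure channels to mixtures -/

/-- Every BMS channel is equivalent to a mixture of binary symmetric channels. -/
lemma IsBMS.exists_bscMix {β : Type*} [MeasurableSpace β] {W : Kernel (ZMod 2) β}
    (hW : IsBMS W) : ∃ (M : Measure I) (_ : IsProbabilityMeasure M) (K : Kernel β (ZMod 2 × I))
      (R : Kernel (ZMod 2 × I) β), IsMarkovKernel K ∧ IsMarkovKernel R ∧
        K ∘ₖ W = bscMix M ∧ R ∘ₖ bscMix M = W := by
  obtain ⟨hWm, K, N, hK, hN, hN1, hKN, R, hR, hsuff⟩ := hW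
  -- For `z = 1` this is the hypothesis on `N`; for `z = 0` it follows by subtraction from the
  -- marginal.
  have hflip : ∀ z S, MeasurableSet S → N ({z} ×ˢ S) =
      (N.snd.withDensity fun a => ENNReal.ofReal (flipProb z a)) S := by
    intro z S hS
    rw [withDensity_apply _ hS]
    rcases zmod_two_cases z with rfl | rfl
    · have h2 : N.snd S = N ({0} ×ˢ S) + N ({1} ×ˢ S) := by
        rw [Measure.snd_apply hS, ← measure_union]
        · congr 1
          ext ⟨z, a⟩
          rcases zmod_two_cases z with rfl | rfl <;> simp
        · rw [Set.disjoint_left]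
          rintro ⟨z, a⟩ ⟨h1, -⟩ ⟨h2, -⟩
          simp only [Set.mem_singleton_iff] at h1 h2
          exact zero_ne_one (h1.symm.trans h2)
        · exact (measurableSet_singleton _).prod hS
      have h3 : N.snd S = (∫⁻ a in S, ENNReal.ofReal (flipProb 0 a) ∂N.snd) + N ({1} ×ˢ S) := by
        rw [hN1 S hS, ← lintegral_add_left (measurable_flipProb 0).ennreal_ofReal]
        have h4 : ∀ a : I, ENNReal.ofReal (flipProb 0 a) + ENNReal.ofReal (a : ℝ) = 1 :=
          fun a => by
            rw [← ENNReal.ofReal_add (flipProb_nonneg 0 a) a.2.1]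
            simp [flipProb]
        simp [h4]
      exact (ENNReal.add_left_inj (measure_ne_top N _)).1 (h2.symm.trans h3)
    · rw [hN1 S hS]
      simp [flipProb]
  have hKW : K ∘ₖ W = bscMix N.snd := by
    ext x : 1
    rw [Kernel.comp_apply, hKN x, bscMix_apply]
    have hm : Measurable fun p : ZMod 2 × I => (x + p.1, p.2) :=
      ((measurable_of_countable fun z => x + z).comp measurable_fst).prodMk measurable_snd
    refine eq_sliceMeasure fun k S hS => ?_
    rw [Measure.map_apply hm ((measurableSet_singleton k).prod hS), ← hflip _ S hS]
    congr 1
    ext ⟨z, a⟩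
    simp [eq_sub_iff_add_eq, add_comm]
  refine ⟨N.snd, inferInstance, K, R, hK, hR, hKW, ?_⟩
  rw [← hKW]
  ext x : 1
  -- The second marginal of the sufficiency identity: averaging `R` over the law of the statistic
  -- recovers `W x`.
  have h := congrArg Measure.snd (hsuff x)
  rw [Measure.snd_compProd, Measure.snd_map_swap, Measure.fst_compProd] at h
  rw [h, Kernel.comp_apply, Kernel.comp_apply]

instance : MeasurableSingletonClass (ZMod 2 ⊕ Unit) :=
  ⟨fun _ => measurableSet_sum_iff.2 ⟨.of_discrete, .of_discrete⟩⟩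

/-- The receiver that guesses a fair bit when the symbol is erased. -/
def unerase : Kernel (ZMod 2 ⊕ Unit) (ZMod 2 × I) :=
  Kernel.ofFunOfCountable fun y => match y with
    | Sum.inl x => Measure.dirac (x, 0)
    | Sum.inr _ => sliceMeasure fun _ => ENNReal.ofReal (1 / 2) • Measure.dirac half

instance : IsMarkovKernel unerase :=
  ⟨fun y => by
    rcases y with x | y
    · change IsProbabilityMeasure (Measure.dirac ((x, 0) : ZMod 2 × I))
      infer_instance
    · refine ⟨?_⟩
      change sliceMeasure (fun _ : ZMod 2 => ENNReal.ofReal (1 / 2) • Measure.dirac half)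
        Set.univ = 1
      rw [← lintegral_one, lintegral_sliceMeasure _ measurable_const]
      simp [ZMod.card, ENNReal.mul_inv_cancel]⟩

/-- The deterministic receiver that erases the symbols of maximal uncertainty. -/
def erase (z : ZMod 2 × I) : ZMod 2 ⊕ Unit := if z.2 = 0 then Sum.inl z.1 else Sum.inr ()

lemma measurable_erase : Measurable erase :=
  Measurable.ite (measurable_snd (measurableSet_singleton 0)) (measurable_inl.comp measurable_fst)
    measurable_const

lemma lintegral_bec (e : I) (x : ZMod 2) (F : ZMod 2 ⊕ Unit → ℝ≥0∞) :
    ∫⁻ y, F y ∂bec e x = ENNReal.ofReal (1 - e) * F (Sum.inl x) +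
      ENNReal.ofReal e * F (Sum.inr ()) := by
  change ∫⁻ y, F y ∂(ENNReal.ofReal (1 - (e : ℝ)) • Measure.dirac (Sum.inl x) +
      ENNReal.ofReal (e : ℝ) • Measure.dirac (Sum.inr ())) = _
  rw [lintegral_add_measure, lintegral_smul_measure, lintegral_smul_measure, lintegral_dirac,
    lintegral_dirac, smul_eq_mul, smul_eq_mul]

lemma lintegral_erasureLaw (τ : I) (F : I → ℝ≥0∞) :
    ∫⁻ a, F a ∂erasureLaw τ = ENNReal.ofReal τ * F 0 + ENNReal.ofReal (1 - τ) * F half := by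
  rw [erasureLaw, lintegral_add_measure, lintegral_smul_measure, lintegral_smul_measure,
    lintegral_dirac, lintegral_dirac, smul_eq_mul, smul_eq_mul]

/-- An erasure is exchanged for a fair bit labelled `half`, and `erase_comp_bscMix` undoes this.
`bec` is indexed by the erasure probability and `erasureLaw` by the capacity, whence
`unitInterval.symm`. -/
lemma unerase_comp_bec (e : I) : unerase ∘ₖ bec e = bscMix (erasureLaw (unitInterval.symm e)) := by
  ext x : 1
  rw [bscMix_apply]
  refine eq_sliceMeasure fun k S hS => ?_
  rw [Kernel.comp_apply' _ _ _ ((measurableSet_singleton k).prod hS), lintegral_bec,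
    withDensity_apply _ hS, ← lintegral_indicator hS, lintegral_erasureLaw]
  change _ * (Measure.dirac ((x, 0) : ZMod 2 × I)) ({k} ×ˢ S) +
    _ * (sliceMeasure fun _ : ZMod 2 => ENNReal.ofReal (1 / 2) • Measure.dirac half) ({k} ×ˢ S) = _
  rw [sliceMeasure_apply _ _ hS, Measure.dirac_apply' _ ((measurableSet_singleton k).prod hS),
    Measure.smul_apply, Measure.dirac_apply' _ hS]
  simp only [unitInterval.coe_symm_eq, sub_sub_cancel]
  congr 2
  · by_cases h0 : (0 : I) ∈ S <;> by_cases hk : x = k <;>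
      simp [h0, hk, flipProb, sub_eq_zero, Set.indicator, eq_comm (a := k)]
  · by_cases h0 : half ∈ S <;> simp [h0, flipProb_half, Set.indicator]

lemma erase_comp_bscMix (e : I) : Kernel.deterministic erase measurable_erase ∘ₖ
    bscMix (erasureLaw (unitInterval.symm e)) = bec e := by
  have hne : half ≠ 0 := fun h => by
    have := congrArg Subtype.val h
    norm_num [coe_half] at this
  ext x s hs
  rw [Kernel.deterministic_comp_eq_map, Kernel.map_apply' _ measurable_erase _ hs,
    ← lintegral_indicator_one (measurable_erase hs), bscMix_apply,
    lintegral_sliceMeasure _ (measurable_one.indicator (measurable_erase hs)),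
    ← lintegral_indicator_one hs, lintegral_bec]
  have hk : ∀ k : ZMod 2, ∫⁻ a, (erase ⁻¹' s).indicator 1 (k, a)
      ∂(erasureLaw (unitInterval.symm e)).withDensity
        (fun a => ENNReal.ofReal (flipProb (k - x) a)) =
      ENNReal.ofReal (1 - e) * (ENNReal.ofReal (flipProb (k - x) 0) *
        s.indicator 1 (Sum.inl k)) + ENNReal.ofReal e * (ENNReal.ofReal (1 / 2) *
        s.indicator 1 (Sum.inr ())) := by
    intro k
    rw [lintegral_withDensity_eq_lintegral_mul _
      (g := fun a => (erase ⁻¹' s).indicator 1 (k, a)) (measurable_flipProb _).ennreal_ofReal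
      ((measurable_one.indicator (measurable_erase hs)).comp measurable_prodMk_left),
      lintegral_erasureLaw]
    have h1 : (erase ⁻¹' s).indicator (1 : ZMod 2 × I → ℝ≥0∞) (k, 0) = s.indicator 1 (Sum.inl k) := by
      change s.indicator 1 (erase (k, 0)) = _
      simp [erase]
    have h2 : (erase ⁻¹' s).indicator (1 : ZMod 2 × I → ℝ≥0∞) (k, half) = s.indicator 1 (Sum.inr ()) := by
      change s.indicator 1 (erase (k, half)) = _
      simp [erase, hne]
    simp only [Pi.mul_apply, h1, h2, flipProb_half, unitInterval.coe_symm_eq, sub_sub_cancel]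
  simp only [hk, Finset.sum_add_distrib, ← Finset.mul_sum]
  congr 2
  · rw [Finset.sum_eq_single x]
    · simp [flipProb]
    · intro k _ hkx
      simp [flipProb, sub_eq_zero, hkx]
    · simp
  · rw [Finset.sum_const, Finset.card_univ, ZMod.card, nsmul_eq_mul, ← mul_assoc]
    rw [one_div, ENNReal.ofReal_inv_of_pos two_pos]
    simp [ENNReal.inv_mul_cancel]

lemma mutualInfo_bec {n : ℕ} (P : Measure (Fin n → ZMod 2)) [IsProbabilityMeasure P] (e : I) :
    mutualInfo P (memoryless n (bec e)) =
      ENNReal.ofReal (∫ a, outInfo (fun x => P.real {x}) a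
        ∂Measure.pi fun _ => erasureLaw (unitInterval.symm e)) / ENNReal.ofReal (Real.log 2) := by
  rw [← mutualInfo_memoryless_bscMix]
  exact mutualInfo_memoryless_eq_of_comp (unerase_comp_bec e) (erase_comp_bscMix e)

lemma coe_symm_of_capacity_bec {e : I} {t : ℝ} (ht : 0 ≤ t)
    (he : capacity (bec e) = ENNReal.ofReal t) : (unitInterval.symm e : ℝ) = t := by
  rw [capacity_eq_of_comp (unerase_comp_bec e) (erase_comp_bscMix e)] at he
  have := integral_biasInfo_of_capacity ht he
  rw [integral_biasInfo_erasureLaw] at this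
  exact mul_right_cancel₀ (Real.log_pos one_lt_two).ne' this

/-! ### The uniform law on a shifted code -/

section Code

variable {n : ℕ} (C : Submodule (ZMod 2) (Fin n → ZMod 2)) (u : Fin n → ZMod 2)

instance : IsProbabilityMeasure (shiftedCodeLaw C u) :=
  isProbabilityMeasure_uniformOn (Set.toFinite _) ⟨0 + u, 0, C.zero_mem, rfl⟩

/-- The difference of two points of `C + u` lies in `C`, so translating by it preserves `C + u`. -/
lemma shiftedCodeLaw_coset {x x' : Fin n → ZMod 2} (hx : (shiftedCodeLaw C u).real {x} ≠ 0)
    (hx' : (shiftedCodeLaw C u).real {x'} ≠ 0) (z : Fin n → ZMod 2) :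
    (shiftedCodeLaw C u).real {z + (x' - x)} = (shiftedCodeLaw C u).real {z} := by
  have happ : ∀ z, shiftedCodeLaw C u {z} =
      (Measure.count {x | ∃ c ∈ C, x = c + u})⁻¹ *
        {x | ∃ c ∈ C, x = c + u}.indicator 1 z := by
    intro z
    rw [shiftedCodeLaw, uniformOn, cond_apply (Set.toFinite _).measurableSet]
    congr 1
    by_cases hz : z ∈ {x | ∃ c ∈ C, x = c + u}
    · rw [Set.inter_eq_right.2 (Set.singleton_subset_iff.2 hz), Measure.count_singleton,
        Set.indicator_of_mem hz, Pi.one_apply]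
    · rw [Set.inter_singleton_eq_empty.2 hz, measure_empty, Set.indicator_of_notMem hz]
  have hmem : ∀ z, (shiftedCodeLaw C u).real {z} ≠ 0 → ∃ c ∈ C, z = c + u := by
    intro z hz
    by_contra hcon
    apply hz
    rw [measureReal_def, happ, Set.indicator_of_notMem
      (show z ∉ {x | ∃ c ∈ C, x = c + u} from hcon), mul_zero, ENNReal.toReal_zero]
  obtain ⟨c, hc, rfl⟩ := hmem x hx
  obtain ⟨c', hc', rfl⟩ := hmem x' hx'
  have hiff : (z + (c' + u - (c + u)) ∈ {x | ∃ c ∈ C, x = c + u}) ↔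
      z ∈ {x | ∃ c ∈ C, x = c + u} := by
    constructor
    · rintro ⟨d, hd, h⟩
      exact ⟨d - (c' - c), C.sub_mem hd (C.sub_mem hc' hc), by
        rw [← sub_eq_iff_eq_add.2 h.symm.symm]; abel⟩
    · rintro ⟨d, hd, rfl⟩
      exact ⟨d + (c' - c), C.add_mem hd (C.sub_mem hc' hc), by abel⟩
  rw [measureReal_def, measureReal_def, happ, happ]
  congr 2
  by_cases h : z ∈ {x | ∃ c ∈ C, x = c + u}
  · rw [Set.indicator_of_mem h, Set.indicator_of_mem (hiff.2 h)]
    rfl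
  · rw [Set.indicator_of_notMem h, Set.indicator_of_notMem fun h' => h (hiff.1 h')]

end Code

end
end BMS

/-! ### The two bounds -/

theorem corollary1 {n : ℕ} (C : Submodule (ZMod 2) (Fin n → ZMod 2)) (u : Fin n → ZMod 2)
    (t : ℝ) (ht : t ∈ Set.Icc (0 : ℝ) 1)
    {𝒴 : Type*} [MeasurableSpace 𝒴] (W : Kernel (ZMod 2) 𝒴)
    (hW : BMS.IsBMS W) (hWcap : BMS.capacity W = ENNReal.ofReal t)
    (e : unitInterval) (he : BMS.capacity (BMS.bec e) = ENNReal.ofReal t)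
    (f : unitInterval) (hf : BMS.capacity (BMS.bec f) = ENNReal.ofReal (BMS.eta t)) :
    ENNReal.ofReal (BMS.alpha t) * BMS.mutualInfo (BMS.shiftedCodeLaw C u) (BMS.memoryless n (BMS.bec f)) ≤
        BMS.mutualInfo (BMS.shiftedCodeLaw C u) (BMS.memoryless n W) ∧
      BMS.mutualInfo (BMS.shiftedCodeLaw C u) (BMS.memoryless n W) ≤
        BMS.mutualInfo (BMS.shiftedCodeLaw C u) (BMS.memoryless n (BMS.bec e)) := by
  open BMS in
  have := hW.1
  obtain ⟨M, hM, K, R, hK, hR, hKW, hRW⟩ := hW.exists_bscMix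
  rw [mutualInfo_memoryless_eq_of_comp hKW hRW, mutualInfo_memoryless_bscMix, mutualInfo_bec,
    mutualInfo_bec]
  rw [capacity_eq_of_comp hKW hRW] at hWcap
  have hMt := integral_biasInfo_of_capacity ht.1 hWcap
  have heta := eta_mem_Icc ht
  have he' := coe_symm_of_capacity_bec ht.1 he
  have hf' := coe_symm_of_capacity_bec heta.1 hf
  have hp : ∀ x, 0 ≤ (shiftedCodeLaw C u).real {x} := fun x => measureReal_nonneg
  have hp1 : ∑ x, (shiftedCodeLaw C u).real {x} = 1 := sum_real_singleton
  constructor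
  · rw [← mul_div_assoc]
    refine ENNReal.div_le_div_right ?_ _
    rw [← ENNReal.ofReal_mul (show 0 ≤ alpha t from div_nonneg ht.1 heta.1)]
    -- If `eta t = 0`, then `alpha t = t / 0 = 0` and the left side vanishes.
    rcases heta.1.eq_or_lt with h0 | h0
    · rw [alpha, ← h0]; simp
    refine ENNReal.ofReal_le_ofReal ?_
    have h := mul_integral_outInfo_erasureLaw_le (τ := unitInterval.symm f) hp hp1
      (fun x x' hx hx' => shiftedCodeLaw_coset C u hx hx') ht.1
      (by rw [hf']; exact integral_sq_bias_le_eta ht hMt) hMt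
    rw [hf'] at h
    rw [alpha, div_mul_eq_mul_div, div_le_iff₀ h0, mul_comm _ (eta t)]
    exact h
  · refine ENNReal.div_le_div_right (ENNReal.ofReal_le_ofReal ?_) _
    exact integral_outInfo_le_erasureLaw hp hp1 (by rw [he', hMt])
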